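/- Let $\Bbbk=\mathbb{C}$ or $\Bbbk=\mathbb{R}$, and let $A',A'',B',B'',C',C''$ be vector spaces over $\Bbbk$. For a tensor $p\in A\otimes B\otimes C$, the rank $R(p)$ is the least $r$ such that $p$ is a linear combination of $r$ simple tensors $a\otimes b\otimes c$ ($a\in A$, $b\in B$, $c\in C$). For $p'\in A'\otimes B'\otimes C'$ and $p''\in A''\otimes B''\otimes C''$, let $p'\oplus p''\in (A'\oplus A'')\otimes(B'\oplus B'')\otimes(C'\oplus C'')$ be the sum of the images of $p'$ and $p''$ under the maps induced by the inclusions of the summands. If $\dim B''\le 3$ and $\dim C''\le 3$ (with $A''$ arbitrary), then for every $p'$ and $p''$ $$R(p'\oplus p'')=R(p')+R(p'').$$ The same equality holds if instead any two of the three spaces $A'',B'',C''$ have dimension at most $3$, or any two of the three spaces $A',B',C'$ have dimension at most $3$. -/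

import Mathlib

open scoped TensorProduct

namespace TensorAdditivity

section

variable {𝕜 : Type*} [Field 𝕜] {A B C : Type*}
  [AddCommGroup A] [Module 𝕜 A] [AddCommGroup B] [Module 𝕜 B] [AddCommGroup C] [Module 𝕜 C]

/-- A simple tensor of `A ⊗ B ⊗ C`: one of the form `a ⊗ b ⊗ c`. -/
def IsSimpleTensor (s : A ⊗[𝕜] (B ⊗[𝕜] C)) : Prop :=
  ∃ (a : A) (b : B) (c : C), s = a ⊗ₜ[𝕜] (b ⊗ₜ[𝕜] c)

/-- `p` is a linear combination of `r` simple tensors. -/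
def HasDecomposition (p : A ⊗[𝕜] (B ⊗[𝕜] C)) (r : ℕ) : Prop :=
  ∃ s : Fin r → A ⊗[𝕜] (B ⊗[𝕜] C),
    (∀ i, IsSimpleTensor (s i)) ∧ p ∈ Submodule.span 𝕜 (Set.range s)

/-- The tensor rank `R(p)`: the least number of simple tensors of which `p` is a linear
combination. Such a number exists by `exists_hasDecomposition`. -/
noncomputable def tensorRank (p : A ⊗[𝕜] (B ⊗[𝕜] C)) : ℕ :=
  sInf {r : ℕ | HasDecomposition p r}

/-- Every tensor is a linear combination of finitely many simple tensors. -/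
theorem exists_hasDecomposition (p : A ⊗[𝕜] (B ⊗[𝕜] C)) : ∃ r : ℕ, HasDecomposition p r := by
  have add : ∀ x y : A ⊗[𝕜] (B ⊗[𝕜] C), (∃ r : ℕ, HasDecomposition x r) →
      (∃ r : ℕ, HasDecomposition y r) → ∃ r : ℕ, HasDecomposition (x + y) r := by
    rintro x y ⟨m, s, hs, hx⟩ ⟨n, t, ht, hy⟩
    refine ⟨m + n, Fin.append s t, fun i => ?_, Submodule.add_mem _ ?_ ?_⟩
    · refine Fin.addCases (fun j => ?_) (fun j => ?_) i
      · simpa using hs j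
      · simpa using ht j
    · refine Submodule.span_mono ?_ hx
      rintro _ ⟨j, rfl⟩
      exact ⟨Fin.castAdd n j, by simp⟩
    · refine Submodule.span_mono ?_ hy
      rintro _ ⟨j, rfl⟩
      exact ⟨Fin.natAdd m j, by simp⟩
  have zero : ∃ r : ℕ, HasDecomposition (0 : A ⊗[𝕜] (B ⊗[𝕜] C)) r :=
    ⟨0, Fin.elim0, fun i => i.elim0, Submodule.zero_mem _⟩
  induction p using TensorProduct.induction_on with
  | zero => exact zero
  | add x y hx hy => exact add x y hx hy
  | tmul a w =>
    induction w using TensorProduct.induction_on with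
    | zero => simpa using zero
    | add x y hx hy => rw [TensorProduct.tmul_add]; exact add _ _ hx hy
    | tmul b c =>
      exact ⟨1, fun _ => a ⊗ₜ[𝕜] (b ⊗ₜ[𝕜] c), fun _ => ⟨a, b, c, rfl⟩,
        Submodule.subset_span ⟨0, rfl⟩⟩

/-- The minimum that defines the rank is attained. -/
theorem hasDecomposition_tensorRank (p : A ⊗[𝕜] (B ⊗[𝕜] C)) :
    HasDecomposition p (tensorRank p) :=
  Nat.sInf_mem (exists_hasDecomposition p)

end

/-- The direct sum `p' ⊕ p''` in `(A' ⊕ A'') ⊗ (B' ⊕ B'') ⊗ (C' ⊕ C'')`: the sum of the images of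
`p'` and `p''` under the maps induced by the inclusions of the summands. -/
noncomputable def tensorDirectSum {𝕜 : Type*} [Field 𝕜] {A' A'' B' B'' C' C'' : Type*}
    [AddCommGroup A'] [Module 𝕜 A'] [AddCommGroup A''] [Module 𝕜 A'']
    [AddCommGroup B'] [Module 𝕜 B'] [AddCommGroup B''] [Module 𝕜 B'']
    [AddCommGroup C'] [Module 𝕜 C'] [AddCommGroup C''] [Module 𝕜 C'']
    (p' : A' ⊗[𝕜] (B' ⊗[𝕜] C')) (p'' : A'' ⊗[𝕜] (B'' ⊗[𝕜] C'')) :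
    (A' × A'') ⊗[𝕜] ((B' × B'') ⊗[𝕜] (C' × C'')) :=
  TensorProduct.map (LinearMap.inl 𝕜 A' A'')
      (TensorProduct.map (LinearMap.inl 𝕜 B' B'') (LinearMap.inl 𝕜 C' C'')) p' +
    TensorProduct.map (LinearMap.inr 𝕜 A' A'')
      (TensorProduct.map (LinearMap.inr 𝕜 B' B'') (LinearMap.inr 𝕜 C' C'')) p''

end TensorAdditivity

namespace TensorAdditivity

open Module

/-! ### Subspaces contained in the span of few elements of a given set. -/

section Covering

variable {K T T' : Type*} [Field K] [AddCommGroup T] [Module K T] [AddCommGroup T'] [Module K T']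

/-! The rank of `p` is the least number of simple tensors of `B ⊗ C` whose span contains the space
of slices `LinearMap.range (rowHom p)`. The slice space of a direct sum is the sum of embedded
copies of the slice spaces `W'` and `W''`. So it suffices to convert a cover of that sum by
independent simple tensors `b i ⊗ c i`, with span `V`, into separate covers of `W'` and `W''` of
total size at most `dim V`.

Let `E ⊆ B''` be spanned by the `B''`-components of those `b i` whose partner `c i` has a nonzero
`C'`-component, and let `F ⊆ C''` be defined symmetrically. By symmetry, `dim F ≤ dim E`. Let `κ`
project `C' × C''` to `C'`. Substitution (`exists_isCoveredBy_fst`) covers `W'` by `dim V - dim (V ⊓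
ker κ) - dim E` tensors, so `W''` may use `dim (V ⊓ ker κ) + dim E`.

Generators lying in `B'' ⊗ C''` are kept for `W''`. The others span `V₁`. The part `W` of `V₁`
inside `B'' ⊗ C''` is killed by `Φ ⊗ Ψ` whenever `Φ` kills `E` and `Ψ` kills `F`; moreover `V₁ ⊓ ker
κ` has dimension at least that of the rows of `W`, plus its columns, plus its remaining core
(`exists_isCoveredBy_snd`). What is left is a statement on `3 × 3` matrices: an excess of `dim E`
simple tensors over that count covers `W`. For `dim E = 0` the space `W` vanishes; for `1` it is a
space of hooks (`isCoveredBy_of_ker_le_span_singleton`); for `2` its matrices have a zero corner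
entry (`isCoveredBy_of_le_ker_map_functional`); for `3` it is arbitrary, and
`isCoveredBy_finrank_add_three` applies. Only the last case needs more of the field than
characteristic zero: a cubic must have a root. -/

theorem finrank_map_add_finrank_inf_ker (f : T →ₗ[K] T') (W : Submodule K T)
    [FiniteDimensional K W] :
    finrank K (W.map f) + finrank K (W ⊓ LinearMap.ker f : Submodule K T) = finrank K W := by
  have h := (f.domRestrict W).finrank_range_add_finrank_ker
  rw [LinearMap.range_domRestrict, LinearMap.ker_domRestrict] at h
  rw [← h]
  congr 1
  have e : (W ⊓ LinearMap.ker f : Submodule K T) =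
      ((LinearMap.ker f).comap W.subtype).map W.subtype := by
    rw [Submodule.map_comap_subtype]
  rw [e, Submodule.finrank_map_subtype_eq]

/-- `W` lies in the span of at most `r` elements of `S`. -/
def IsCoveredBy (S : Set T) (W : Submodule K T) (r : ℕ) : Prop :=
  ∃ s : Finset T, (s : Set T) ⊆ S ∧ s.card ≤ r ∧ W ≤ Submodule.span K (s : Set T)

theorem IsCoveredBy.mono {S : Set T} {W W' : Submodule K T} {r r' : ℕ} (h : IsCoveredBy S W r)
    (hW : W' ≤ W) (hr : r ≤ r') : IsCoveredBy S W' r' := by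
  obtain ⟨s, hs, hc, hsp⟩ := h
  exact ⟨s, hs, hc.trans hr, hW.trans hsp⟩

theorem IsCoveredBy.bot (S : Set T) : IsCoveredBy S (⊥ : Submodule K T) 0 :=
  ⟨∅, by simp, by simp, bot_le⟩

theorem IsCoveredBy.sup {S : Set T} {W W' : Submodule K T} {r r' : ℕ} (h : IsCoveredBy S W r)
    (h' : IsCoveredBy S W' r') : IsCoveredBy S (W ⊔ W') (r + r') := by
  classical
  obtain ⟨s, hs, hc, hsp⟩ := h
  obtain ⟨t, ht, hc', hsp'⟩ := h'
  refine ⟨s ∪ t, by simp [hs, ht], (Finset.card_union_le s t).trans (by omega), sup_le ?_ ?_⟩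
  · exact hsp.trans (Submodule.span_mono (by simp))
  · exact hsp'.trans (Submodule.span_mono (by simp))

theorem IsCoveredBy.map {S : Set T} {S' : Set T'} {W : Submodule K T} {r : ℕ}
    (h : IsCoveredBy S W r) (f : T →ₗ[K] T') (hf : ∀ x ∈ S, f x ∈ S') :
    IsCoveredBy S' (W.map f) r := by
  classical
  obtain ⟨s, hs, hc, hsp⟩ := h
  refine ⟨s.image f, ?_, Finset.card_image_le.trans hc, ?_⟩
  · intro y hy
    obtain ⟨x, hx, rfl⟩ := Finset.mem_image.1 (Finset.mem_coe.1 hy)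
    exact hf x (hs hx)
  · rw [Finset.coe_image, ← Submodule.map_span]
    exact Submodule.map_mono hsp

theorem IsCoveredBy.singleton {S : Set T} {x : T} (hx : x ∈ S) :
    IsCoveredBy S (Submodule.span K {x}) 1 :=
  ⟨{x}, by simpa using hx, by simp, by simp⟩

theorem IsCoveredBy.of_family {S : Set T} {ι : Type*} [Fintype ι] (v : ι → T) (hv : ∀ i, v i ∈ S) :
    IsCoveredBy S (Submodule.span K (Set.range v)) (Fintype.card ι) := by
  classical
  refine ⟨Finset.univ.image v, ?_, Finset.card_image_le, ?_⟩
  · intro y hy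
    obtain ⟨i, -, rfl⟩ := Finset.mem_image.1 (Finset.mem_coe.1 hy)
    exact hv i
  · simp

/-- The inductive step of the constructions below: once `O` is paid for, enlarging by `X` costs only
`dim X`, provided `X` has a spanning set of elements that are simple modulo `O`. -/
theorem IsCoveredBy.sup_span {S : Set T} {O X : Submodule K T} {r : ℕ} (h : IsCoveredBy S O r)
    [FiniteDimensional K X] (A : Set T) (hX : X ≤ Submodule.span K A) (hA : A ⊆ X)
    (hsimple : ∀ x ∈ A, ∃ s ∈ S, x - s ∈ O) : IsCoveredBy S (O ⊔ X) (r + finrank K X) := by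
  classical
  obtain ⟨κ, a, -, hspan, hli⟩ := exists_linearIndependent' K (Subtype.val : A → T)
  rw [Subtype.range_coe] at hspan
  have hmem : ∀ k, ((Subtype.val : A → T) ∘ a) k ∈ X := fun k => hA (a k).2
  have hli' : LinearIndependent K (fun k => (⟨_, hmem k⟩ : X)) :=
    LinearIndependent.of_comp X.subtype hli
  have : Finite κ := hli'.finite
  have := Fintype.ofFinite κ
  choose t htS htO using fun k => hsimple _ (a k).2
  refine (h.sup (IsCoveredBy.of_family t htS)).mono (sup_le le_sup_left ?_) ?_
  · rw [← hspan] at hX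
    refine hX.trans (Submodule.span_le.2 ?_)
    rintro _ ⟨k, rfl⟩
    have := add_mem (Submodule.mem_sup_left (htO k)) (Submodule.mem_sup_right
      (Submodule.subset_span ⟨k, rfl⟩) : t k ∈ O ⊔ Submodule.span K (Set.range t))
    simpa using this
  · exact Nat.add_le_add_left hli'.fintype_card_le_finrank _

theorem IsCoveredBy.of_span {S : Set T} {X : Submodule K T} [FiniteDimensional K X] (A : Set T)
    (hX : X ≤ Submodule.span K A) (hA : A ⊆ X) (hS : A ⊆ S) : IsCoveredBy S X (finrank K X) := by
  have := (IsCoveredBy.bot (K := K) S).sup_span A hX hA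
    fun x hx => ⟨x, hS hx, by simp⟩
  simpa using this

end Covering

/-! ### Splitting a cover of a direct sum: the dimension counts for the two summands. -/

section Leakage

variable {K : Type*} [Field K]

/-- The simple tensors of `B ⊗ C`. -/
def simpleTensors (K B C : Type*) [Field K] [AddCommGroup B] [Module K B] [AddCommGroup C]
    [Module K C] : Set (B ⊗[K] C) :=
  {s | ∃ (b : B) (c : C), s = b ⊗ₜ[K] c}

variable {B C B₁ C₁ : Type*} [AddCommGroup B] [Module K B] [AddCommGroup C] [Module K C]
  [AddCommGroup B₁] [Module K B₁] [AddCommGroup C₁] [Module K C₁]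

theorem tmul_mem_simpleTensors (b : B) (c : C) : b ⊗ₜ[K] c ∈ simpleTensors K B C := ⟨b, c, rfl⟩

theorem map_mem_simpleTensors (f : B →ₗ[K] B₁) (g : C →ₗ[K] C₁) {x : B ⊗[K] C}
    (hx : x ∈ simpleTensors K B C) : TensorProduct.map f g x ∈ simpleTensors K B₁ C₁ := by
  obtain ⟨b, c, rfl⟩ := hx
  exact ⟨f b, g c, by simp⟩

theorem comm_mem_simpleTensors {x : B ⊗[K] C} (hx : x ∈ simpleTensors K B C) :
    TensorProduct.comm K B C x ∈ simpleTensors K C B := by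
  obtain ⟨b, c, rfl⟩ := hx
  exact ⟨c, b, by simp⟩

theorem _root_.LinearIndependent.exists_linearMap_apply_eq {ι : Type*} {v : ι → B}
    (hv : LinearIndependent K v) (w : ι → C) : ∃ f : B →ₗ[K] C, ∀ i, f (v i) = w i := by
  obtain ⟨f, hf⟩ := LinearMap.exists_extend ((Basis.span hv).constr K w)
  refine ⟨f, fun i => ?_⟩
  have h := LinearMap.congr_fun hf (Basis.span hv i)
  rw [Basis.constr_basis] at h
  rw [← h, LinearMap.comp_apply, Submodule.subtype_apply, Basis.span_apply]

theorem _root_.LinearIndependent.tmul_of_ne_zero {ι : Type*} {v : ι → B}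
    (hv : LinearIndependent K v) (c : ι → C) (hc : ∀ i, c i ≠ 0) :
    LinearIndependent K fun i => v i ⊗ₜ[K] c i := by
  classical
  rw [linearIndependent_iff']
  intro s g hg i hi
  obtain ⟨φ, hφ⟩ := hv.exists_linearMap_apply_eq (Pi.single i (1 : K))
  have h := congrArg (fun t => TensorProduct.lid K C (TensorProduct.map φ .id t)) hg
  simpa [hφ, Pi.single_apply, hi, hc i] using h

variable {B' B'' C' C'' : Type*} [AddCommGroup B'] [Module K B'] [AddCommGroup B''] [Module K B'']
  [AddCommGroup C'] [Module K C'] [AddCommGroup C''] [Module K C'']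

/-- The substitution method: the vectors that leak from `B'` into `B''` can be eliminated. -/
theorem exists_isCoveredBy_fst {ι : Type*} [Finite ι] (b : ι → B' × B'') (c : ι → C' × C'')
    (W' : Submodule K (B' ⊗[K] C'))
    (hW : W'.map (TensorProduct.map (.inl K B' B'') (.inl K C' C'')) ≤
      Submodule.span K (Set.range fun i => b i ⊗ₜ[K] c i)) :
    ∃ r, IsCoveredBy (simpleTensors K B' C') W' r ∧
      r + finrank K (Submodule.span K (Set.range fun i => b i ⊗ₜ[K] c i) ⊓
            LinearMap.ker (TensorProduct.map (.id : B' × B'' →ₗ[K] B' × B'')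
              (.fst K C' C'')) : Submodule K ((B' × B'') ⊗[K] (C' × C''))) +
        finrank K (Submodule.span K ((fun i => (b i).2) '' {i | (c i).1 ≠ 0})) ≤
      finrank K (Submodule.span K (Set.range fun i => b i ⊗ₜ[K] c i)) := by
  set V := Submodule.span K (Set.range fun i => b i ⊗ₜ[K] c i) with hV
  set κ := TensorProduct.map (.id : B' × B'' →ₗ[K] B' × B'') (.fst K C' C'')
  have : FiniteDimensional K V := FiniteDimensional.span_of_finite K (Set.finite_range _)
  obtain ⟨J, a, ha, hspan, hli⟩ :=
    exists_linearIndependent' K (fun i : {i | (c i).1 ≠ 0} => (b i).2)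
  rw [Set.image_eq_range, ← hspan]
  -- With this `θ` the map `id + θ` restricts to the identity on `B'` and kills every `b (a j)`.
  -- Hence `f` recovers `W'` and loses one generator for each basis vector of the leak.
  obtain ⟨θ, hθ⟩ := hli.exists_linearMap_apply_eq (fun j => -(b (a j)).1)
  set f := TensorProduct.map (LinearMap.coprod .id θ) (.fst K C' C'') with hf
  have hWf : W' ≤ V.map f := by
    intro w hw
    refine ⟨_, hW ⟨w, hw, rfl⟩, ?_⟩
    rw [hf, ← LinearMap.comp_apply, ← TensorProduct.map_comp, LinearMap.coprod_inl,
      LinearMap.fst_comp_inl, TensorProduct.map_id, LinearMap.id_apply]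
  have hVf : V.map f = Submodule.span K (Set.range fun i => f (b i ⊗ₜ[K] c i)) := by
    rw [hV, Submodule.map_span, ← Set.range_comp]; rfl
  have hcov : IsCoveredBy (simpleTensors K B' C') (V.map f) (finrank K (V.map f)) := by
    refine IsCoveredBy.of_span _ hVf.le ?_ ?_
    · rw [hVf]; exact Submodule.subset_span
    · rintro _ ⟨i, rfl⟩
      exact map_mem_simpleTensors _ _ (tmul_mem_simpleTensors _ _)
  refine ⟨_, hcov.mono hWf le_rfl, ?_⟩
  have h1 := finrank_map_add_finrank_inf_ker f V
  have h2 := finrank_map_add_finrank_inf_ker κ (V ⊓ LinearMap.ker f)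
  -- Since `f` factors through `κ`, two losses add up: `V ⊓ ker κ`, and the `κ`-image of the killed
  -- generators.
  have hker : LinearMap.ker κ ≤ LinearMap.ker f := by
    have : f = (TensorProduct.map (LinearMap.coprod .id θ) .id).comp κ := by
      rw [← TensorProduct.map_comp, LinearMap.comp_id, LinearMap.id_comp]
    rw [this]
    exact LinearMap.ker_le_ker_comp _ _
  rw [inf_assoc, inf_eq_right.2 hker] at h2
  have : Finite J := Finite.of_injective a ha
  have := Fintype.ofFinite J
  have hli2 : LinearIndependent K fun j => κ (b (a j) ⊗ₜ[K] c (a j)) := by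
    refine LinearIndependent.of_comp (TensorProduct.map (.snd K B' B'') .id) ?_
    simpa [κ, Function.comp_def] using hli.tmul_of_ne_zero (fun j => (c (a j)).1) fun j => (a j).2
  have h3 : Fintype.card J ≤ finrank K ((V ⊓ LinearMap.ker f).map κ) := by
    rw [← finrank_span_eq_card hli2]
    refine Submodule.finrank_mono (Submodule.span_le.2 ?_)
    rintro _ ⟨j, rfl⟩
    refine ⟨_, ⟨Submodule.subset_span ⟨a j, rfl⟩, ?_⟩, rfl⟩
    have := hθ j
    simp only [Function.comp_apply] at this
    simp [f, this]
  rw [finrank_span_eq_card hli]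
  omega

/-- The part of `W''` that is not accounted for by tensors of `B'' ⊗ C''` costs as much as the
rest of the kernel. -/
theorem exists_isCoveredBy_snd {ι : Type*} [Finite ι] (b : ι → B' × B'') (c : ι → C' × C'')
    (hli : LinearIndependent K fun i => b i ⊗ₜ[K] c i)
    (W'' : Submodule K (B'' ⊗[K] C''))
    (hW : W''.map (TensorProduct.map (.inr K B' B'') (.inr K C' C'')) ≤
      Submodule.span K (Set.range fun i => b i ⊗ₜ[K] c i))
    (Φ : B'' →ₗ[K] B₁) (Ψ : C'' →ₗ[K] C₁)
    (hΦ : ∀ i, (c i).1 ≠ 0 → Φ (b i).2 = 0) (hΨ : ∀ i, (b i).1 ≠ 0 → Ψ (c i).2 = 0) (d : ℕ)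
    (hd : ∀ W : Submodule K (B'' ⊗[K] C''), FiniteDimensional K W →
      W ≤ LinearMap.ker (TensorProduct.map Φ Ψ) →
      IsCoveredBy (simpleTensors K B'' C'') W
        (finrank K (W.map (TensorProduct.map Φ (.id : C'' →ₗ[K] C''))) +
          finrank K (W.map (TensorProduct.map (.id : B'' →ₗ[K] B'') Ψ)) +
          finrank K (W ⊓ LinearMap.ker (TensorProduct.map (.id : B'' →ₗ[K] B'') Ψ) ⊓
            LinearMap.ker (TensorProduct.map Φ (.id : C'' →ₗ[K] C'')) :
              Submodule K (B'' ⊗[K] C'')) + d)) :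
    IsCoveredBy (simpleTensors K B'' C'') W''
      (finrank K (Submodule.span K (Set.range fun i => b i ⊗ₜ[K] c i) ⊓
            LinearMap.ker (TensorProduct.map (.id : B' × B'' →ₗ[K] B' × B'')
              (.fst K C' C'')) : Submodule K ((B' × B'') ⊗[K] (C' × C''))) + d) := by
  classical
  set s : ι → (B' × B'') ⊗[K] (C' × C'') := fun i => b i ⊗ₜ[K] c i with hs
  set κ := TensorProduct.map (.id : B' × B'' →ₗ[K] B' × B'') (.fst K C' C'')
  set j := TensorProduct.map (.inr K B' B'') (.inr K C' C'') with hj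
  set τ := TensorProduct.map (.snd K B' B'') (.snd K C' C'') with hτ
  have hτj : ∀ x, τ (j x) = x := fun x => by
    rw [hτ, hj, ← LinearMap.comp_apply, ← TensorProduct.map_comp, LinearMap.snd_comp_inr,
      LinearMap.snd_comp_inr, TensorProduct.map_id, LinearMap.id_apply]
  have hκj : ∀ x, κ (j x) = 0 := fun x => by
    rw [hj, ← LinearMap.comp_apply, ← TensorProduct.map_comp, LinearMap.fst_comp_inr,
      TensorProduct.map_zero_right, LinearMap.zero_apply]
  have hjinj : Function.Injective j := Function.LeftInverse.injective hτj
  -- `N` indexes the generators already in `B'' ⊗ C''`; they lie in `ker κ` and are reused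
  -- unchanged.
  set N : Set ι := {i | (b i).1 = 0 ∧ (c i).1 = 0} with hN
  have hfd : ∀ A : Set ι, FiniteDimensional K (Submodule.span K (s '' A)) := fun A =>
    FiniteDimensional.span_of_finite K (A.toFinite.image _)
  have := hfd N
  have := hfd Nᶜ
  set V₁ := Submodule.span K (s '' Nᶜ) with hV₁
  set U := Submodule.span K (s '' N) with hU
  have hV : Submodule.span K (Set.range s) = U ⊔ V₁ := by
    rw [hU, hV₁, ← Submodule.span_union, ← Set.image_union, Set.union_compl_self, Set.image_univ]
  have hdisj : Disjoint U V₁ := hli.disjoint_span_image disjoint_compl_right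
  have hNs : ∀ i ∈ N, s i = j ((b i).2 ⊗ₜ[K] (c i).2) := by
    rintro i ⟨h1, h2⟩
    simp [hs, hj, ← h1, ← h2]
  have hUκ : U ≤ LinearMap.ker κ := by
    rw [hU, Submodule.span_le]
    rintro _ ⟨i, hi, rfl⟩
    rw [hNs i hi]; exact hκj _
  set W := V₁.comap j with hW₁
  have hWV : W.map j ≤ V₁ := Submodule.map_comap_le _ _
  have : FiniteDimensional K (W.map j) := Submodule.finiteDimensional_of_le hWV
  have hfW : FiniteDimensional K W :=
    Module.Finite.equiv (Submodule.equivMapOfInjective j hjinj W).symm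
  set Ψ' := TensorProduct.map (.id : B'' →ₗ[K] B'') Ψ with hΨ'
  set Φ' := TensorProduct.map Φ (.id : C'' →ₗ[K] C'') with hΦ'
  have hNΦ : ∀ i ∈ Nᶜ, (c i).1 ≠ 0 → Φ' (τ (s i)) = 0 := by
    intro i _ h
    simp [hΦ', hτ, hs, hΦ i h]
  have hNΨ : ∀ i ∈ Nᶜ, (c i).1 = 0 → Ψ' (τ (s i)) = 0 := by
    intro i hi h
    have : (b i).1 ≠ 0 := fun h' => hi ⟨h', h⟩
    simp [hΨ', hτ, hs, hΨ i this]
  have hWker : W ≤ LinearMap.ker (TensorProduct.map Φ Ψ) := by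
    intro w hw
    have : V₁ ≤ LinearMap.ker ((TensorProduct.map Φ Ψ).comp τ) := by
      rw [hV₁, Submodule.span_le]
      rintro _ ⟨i, hi, rfl⟩
      by_cases h : (c i).1 = 0
      · have h2 := hNΨ i hi h
        have : (TensorProduct.map Φ Ψ) = (TensorProduct.map Φ .id).comp Ψ' := by
          rw [hΨ', ← TensorProduct.map_comp, LinearMap.comp_id, LinearMap.id_comp]
        simp [this, h2]
      · have h2 := hNΦ i hi h
        have : (TensorProduct.map Φ Ψ) = (TensorProduct.map .id Ψ).comp Φ' := by
          rw [hΦ', ← TensorProduct.map_comp, LinearMap.comp_id, LinearMap.id_comp]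
        simp [this, h2]
    have := this hw
    simpa [hτj] using this
  have hcW := hd W hfW hWker
  set K₁ := V₁ ⊓ LinearMap.ker κ with hK₁
  have hWK : W.map j ≤ K₁ := le_inf hWV (by rintro _ ⟨w, -, rfl⟩; exact hκj w)
  -- Filtering `K₁` by `Ψ' ∘ τ` and, on its kernel, by `Φ' ∘ τ` gives three pieces, each at least as
  -- large as the corresponding piece for `W`.
  have e1 := finrank_map_add_finrank_inf_ker (Ψ'.comp τ) K₁
  have e2 := finrank_map_add_finrank_inf_ker (Φ'.comp τ) (K₁ ⊓ LinearMap.ker (Ψ'.comp τ))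
  have i1 : finrank K (W.map Ψ') ≤ finrank K (K₁.map (Ψ'.comp τ)) := by
    refine Submodule.finrank_mono ?_
    rintro _ ⟨w, hw, rfl⟩
    exact ⟨j w, hWK ⟨w, hw, rfl⟩, by simp [hτj]⟩
  have i2 : finrank K (W.map Φ') ≤
      finrank K ((K₁ ⊓ LinearMap.ker (Ψ'.comp τ)).map (Φ'.comp τ)) := by
    refine Submodule.finrank_mono ?_
    rintro _ ⟨w, hw, rfl⟩
    -- Restricting to the kernel loses nothing: a generator of `V₁` with `(c i).1 ≠ 0` dies under
    -- `Φ' ∘ τ`, and one with `(c i).1 = 0` lies in `K₁` and is killed by `Ψ' ∘ τ`.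
    have : V₁.map (Φ'.comp τ) ≤ (K₁ ⊓ LinearMap.ker (Ψ'.comp τ)).map (Φ'.comp τ) := by
      rw [hV₁, Submodule.map_span, Submodule.span_le]
      rintro _ ⟨_, ⟨i, hi, rfl⟩, rfl⟩
      by_cases h : (c i).1 = 0
      · refine ⟨s i, ⟨⟨Submodule.subset_span ⟨i, hi, rfl⟩, ?_⟩, ?_⟩, rfl⟩
        · simp [hs, κ, h]
        · exact hNΨ i hi h
      · have h2 := hNΦ i hi h
        simp only [LinearMap.comp_apply, h2]
        exact zero_mem _
    exact this ⟨j w, hw, by simp [hτj]⟩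
  have i3 : finrank K (W ⊓ LinearMap.ker Ψ' ⊓ LinearMap.ker Φ' : Submodule K (B'' ⊗[K] C'')) ≤
      finrank K (K₁ ⊓ LinearMap.ker (Ψ'.comp τ) ⊓ LinearMap.ker (Φ'.comp τ) :
        Submodule K ((B' × B'') ⊗[K] (C' × C''))) := by
    rw [(Submodule.equivMapOfInjective j hjinj (W ⊓ LinearMap.ker Ψ' ⊓ LinearMap.ker Φ')).finrank_eq]
    refine Submodule.finrank_mono ?_
    rintro _ ⟨w, ⟨⟨hw, h1⟩, h2⟩, rfl⟩
    refine ⟨⟨hWK ⟨w, hw, rfl⟩, ?_⟩, ?_⟩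
    · simpa [hτj] using h1
    · simpa [hτj] using h2
  have hcU : IsCoveredBy (simpleTensors K B'' C'') (U.map τ) (finrank K U) := by
    have h0 := IsCoveredBy.of_span (S := simpleTensors K (B' × B'') (C' × C'')) (X := U) (s '' N)
      le_rfl Submodule.subset_span
      (by rintro _ ⟨i, -, rfl⟩; exact tmul_mem_simpleTensors _ _)
    exact h0.map τ fun x hx => map_mem_simpleTensors _ _ hx
  refine (hcU.sup hcW).mono ?_ ?_
  · intro w hw
    have h := hW ⟨w, hw, rfl⟩
    rw [hV] at h
    obtain ⟨u, hu, v, hv, huv⟩ := Submodule.mem_sup.1 h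
    have hju : j (τ u) = u := by
      have : U ≤ LinearMap.ker (j.comp τ - .id) := by
        rw [hU, Submodule.span_le]
        rintro _ ⟨i, hi, rfl⟩
        rw [hNs i hi]
        simp [hτj]
      simpa [sub_eq_zero] using this hu
    refine Submodule.mem_sup.2 ⟨τ u, ⟨u, hu, rfl⟩, w - τ u, ?_, by abel⟩
    have : j (w - τ u) = v := by rw [map_sub, hju, ← huv]; abel
    change j (w - τ u) ∈ V₁
    rwa [this]
  · have hle : U ⊔ K₁ ≤ Submodule.span K (Set.range s) ⊓ LinearMap.ker κ := by
      rw [hV]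
      exact sup_le (le_inf le_sup_left hUκ) (inf_le_inf_right _ le_sup_right)
    have : FiniteDimensional K (Submodule.span K (Set.range s)) :=
      FiniteDimensional.span_of_finite K (Set.finite_range _)
    have h1 := Submodule.finrank_mono hle
    have h2 := Submodule.finrank_sup_add_finrank_inf_eq U K₁
    rw [(hdisj.mono_right inf_le_left).eq_bot, finrank_bot] at h2
    omega

end Leakage

/-! ### Matrices supported on one row and one column; bases of planes in general position. -/

section Hooks

variable {K : Type*} [Field K] {B C B₁ C₁ : Type*} [AddCommGroup B] [Module K B] [AddCommGroup C]
  [Module K C] [AddCommGroup B₁] [Module K B₁] [AddCommGroup C₁] [Module K C₁]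

theorem exists_map_id_eq_tmul (g : C₁ →ₗ[K] C) {y : C} (hg : ∀ c, g c ∈ Submodule.span K {y})
    (z : B ⊗[K] C₁) : ∃ b : B, TensorProduct.map .id g z = b ⊗ₜ[K] y := by
  induction z using TensorProduct.induction_on with
  | zero => exact ⟨0, by simp⟩
  | add z₁ z₂ h₁ h₂ =>
    obtain ⟨b₁, h₁⟩ := h₁
    obtain ⟨b₂, h₂⟩ := h₂
    exact ⟨b₁ + b₂, by rw [map_add, h₁, h₂, TensorProduct.add_tmul]⟩
  | tmul b c =>
    obtain ⟨a, ha⟩ := Submodule.mem_span_singleton.1 (hg c)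
    exact ⟨a • b, by rw [TensorProduct.map_tmul, ← ha, TensorProduct.smul_tmul]; rfl⟩

theorem exists_map_id_eq_tmul' (g : B₁ →ₗ[K] B) {x : B} (hg : ∀ b, g b ∈ Submodule.span K {x})
    (z : B₁ ⊗[K] C) : ∃ c : C, TensorProduct.map g .id z = x ⊗ₜ[K] c := by
  obtain ⟨c, hc⟩ := exists_map_id_eq_tmul g hg (TensorProduct.comm K _ _ z)
  refine ⟨c, (TensorProduct.comm K _ _).injective ?_⟩
  rw [TensorProduct.comm_tmul, ← hc, TensorProduct.map_comm]

/-- A space of matrices supported in one row and one column. -/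
theorem isCoveredBy_of_ker_le_span_singleton {Φ : B →ₗ[K] B₁} {Ψ : C →ₗ[K] C₁}
    (hΦ : Function.Surjective Φ) (hΨ : Function.Surjective Ψ) {x : B} {y : C}
    (hx : LinearMap.ker Φ ≤ Submodule.span K {x}) (hy : LinearMap.ker Ψ ≤ Submodule.span K {y})
    (W : Submodule K (B ⊗[K] C)) [FiniteDimensional K W]
    (hW : W ≤ LinearMap.ker (TensorProduct.map Φ Ψ)) :
    IsCoveredBy (simpleTensors K B C) W
      (finrank K (W.map (TensorProduct.map Φ (.id : C →ₗ[K] C))) +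
        finrank K (W.map (TensorProduct.map (.id : B →ₗ[K] B) Ψ)) + 1) := by
  obtain ⟨σ, hσ⟩ := Φ.exists_rightInverse_of_surjective (LinearMap.range_eq_top.2 hΦ)
  obtain ⟨τ, hτ⟩ := Ψ.exists_rightInverse_of_surjective (LinearMap.range_eq_top.2 hΨ)
  have hσ' : ∀ b, Φ (σ b) = b := LinearMap.congr_fun hσ
  have hτ' : ∀ c, Ψ (τ c) = c := LinearMap.congr_fun hτ
  have hy' : ∀ c, (LinearMap.id - τ.comp Ψ : C →ₗ[K] C) c ∈ Submodule.span K {y} := fun c =>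
    hy (by simp [hτ'])
  have hx' : ∀ b, (LinearMap.id - σ.comp Φ : B →ₗ[K] B) b ∈ Submodule.span K {x} := fun b =>
    hx (by simp [hσ'])
  set Φ' := TensorProduct.map Φ (.id : C →ₗ[K] C)
  set Ψ' := TensorProduct.map (.id : B →ₗ[K] B) Ψ
  -- As `Φ ⊗ Ψ` kills `w`, the image `Φ' w` lies in `B₁ ⊗ ker Ψ`, where `ker Ψ` is at most a line.
  -- So every element of `W.map Φ'` is simple.
  have c1 : IsCoveredBy (simpleTensors K B₁ C) (W.map Φ') (finrank K (W.map Φ')) := by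
    refine IsCoveredBy.of_span (W.map Φ') Submodule.subset_span le_rfl ?_
    rintro _ ⟨w, hw, rfl⟩
    obtain ⟨b, hb⟩ := exists_map_id_eq_tmul _ hy' (Φ' w)
    refine ⟨b, y, ?_⟩
    have e : (TensorProduct.map .id (.id - τ.comp Ψ)).comp Φ' =
        Φ' - (TensorProduct.map .id τ).comp (TensorProduct.map Φ Ψ) :=
      TensorProduct.ext' fun b c => by simp [Φ', TensorProduct.tmul_sub]
    have e' := LinearMap.congr_fun e w
    rwa [LinearMap.comp_apply, hb, LinearMap.sub_apply, LinearMap.comp_apply,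
      LinearMap.mem_ker.1 (hW hw), map_zero, sub_zero, eq_comm] at e'
  have c2 : IsCoveredBy (simpleTensors K B C₁) (W.map Ψ') (finrank K (W.map Ψ')) := by
    refine IsCoveredBy.of_span (W.map Ψ') Submodule.subset_span le_rfl ?_
    rintro _ ⟨w, hw, rfl⟩
    obtain ⟨c, hc⟩ := exists_map_id_eq_tmul' _ hx' (Ψ' w)
    refine ⟨x, c, ?_⟩
    have e : (TensorProduct.map (.id - σ.comp Φ) .id).comp Ψ' =
        Ψ' - (TensorProduct.map σ .id).comp (TensorProduct.map Φ Ψ) :=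
      TensorProduct.ext' fun b c => by simp [Ψ', TensorProduct.sub_tmul]
    have e' := LinearMap.congr_fun e w
    rwa [LinearMap.comp_apply, hc, LinearMap.sub_apply, LinearMap.comp_apply,
      LinearMap.mem_ker.1 (hW hw), map_zero, sub_zero, eq_comm] at e'
  have c1' := c1.map (TensorProduct.map σ .id) (S' := simpleTensors K B C)
    fun z hz => map_mem_simpleTensors _ _ hz
  have c2' := c2.map (TensorProduct.map .id τ) (S' := simpleTensors K B C)
    fun z hz => map_mem_simpleTensors _ _ hz
  refine ((c1'.sup c2').sup (IsCoveredBy.singleton (tmul_mem_simpleTensors x y))).mono ?_ le_rfl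
  intro w hw
  -- For the commuting projections `P = σΦ ⊗ id` and `Q = id ⊗ τΨ`: `1 = P + Q + (1 - P)(1 - Q) -
  -- PQ`. Here `PQ` vanishes on `W`, and `(1 - P)(1 - Q)` has image in the line of `x ⊗ y`.
  have key : (LinearMap.id : B ⊗[K] C →ₗ[K] B ⊗[K] C) =
      ((TensorProduct.map σ .id).comp Φ' + (TensorProduct.map .id τ).comp Ψ') +
      ((TensorProduct.map (.id - σ.comp Φ) .id).comp (TensorProduct.map .id (.id - τ.comp Ψ)) -
        (TensorProduct.map σ τ).comp (TensorProduct.map Φ Ψ)) := by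
    refine TensorProduct.ext' fun b c => ?_
    simp only [Φ', Ψ', LinearMap.id_apply, LinearMap.add_apply, LinearMap.sub_apply,
      LinearMap.comp_apply, TensorProduct.map_tmul, TensorProduct.sub_tmul, TensorProduct.tmul_sub, map_sub]
    abel
  have key' := LinearMap.congr_fun key w
  simp only [LinearMap.id_apply, LinearMap.add_apply, LinearMap.sub_apply,
    LinearMap.comp_apply, LinearMap.mem_ker.1 (hW hw), map_zero, sub_zero] at key'
  rw [key']
  refine Submodule.add_mem_sup (Submodule.add_mem_sup ⟨_, ⟨w, hw, rfl⟩, rfl⟩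
    ⟨_, ⟨w, hw, rfl⟩, rfl⟩) ?_
  obtain ⟨b, hb⟩ := exists_map_id_eq_tmul _ hy' w
  obtain ⟨a, ha⟩ := Submodule.mem_span_singleton.1 (hx' b)
  rw [hb, TensorProduct.map_tmul, ← ha]
  exact Submodule.mem_span_singleton.2 ⟨a, by simp [TensorProduct.smul_tmul']⟩

/-- The vectors `x₀ + x₁` and `x₀ - x₁` suffice, since `2` is invertible. -/
theorem le_span_general_position [CharZero K] {E : Submodule K B} {x₀ x₁ : B} (h₀ : x₀ ∈ E)
    (h₁ : x₁ ∈ E) (hE : E ≤ Submodule.span K {x₀, x₁}) :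
    E ≤ Submodule.span K
      {z | z ∈ E ∧ ∃ t₀ t₁ : K, t₀ ≠ 0 ∧ t₁ ≠ 0 ∧ z = t₀ • x₀ + t₁ • x₁} := by
  set S := {z | z ∈ E ∧ ∃ t₀ t₁ : K, t₀ ≠ 0 ∧ t₁ ≠ 0 ∧ z = t₀ • x₀ + t₁ • x₁} with hS
  have m1 : x₀ + x₁ ∈ Submodule.span K S :=
    Submodule.subset_span ⟨add_mem h₀ h₁, 1, 1, one_ne_zero, one_ne_zero, by module⟩
  have m2 : x₀ - x₁ ∈ Submodule.span K S :=
    Submodule.subset_span ⟨sub_mem h₀ h₁, 1, -1, one_ne_zero, by simp, by module⟩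
  have e0 : x₀ ∈ Submodule.span K S := by
    have e : x₀ = (2⁻¹ : K) • (x₀ + x₁) + (2⁻¹ : K) • (x₀ - x₁) := by
      match_scalars <;> norm_num
    have := add_mem (Submodule.smul_mem _ (2⁻¹ : K) m1) (Submodule.smul_mem _ (2⁻¹ : K) m2)
    rwa [← e] at this
  have e1 : x₁ ∈ Submodule.span K S := by
    have := sub_mem m1 e0
    rwa [add_sub_cancel_left] at this
  refine hE.trans (Submodule.span_le.2 ?_)
  rintro w (rfl | rfl)
  · exact e0
  · exact e1

/-- A plane has a basis in general position with respect to a given subspace. -/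
theorem exists_span_pair_general_position [CharZero K] {E Q : Submodule K B} (hE : finrank K E = 2)
    (hQ : Q ≤ E) : ∃ x₀ ∈ E, ∃ x₁ ∈ E, E ≤ Submodule.span K {x₀, x₁} ∧
      Q ≤ Submodule.span K {z | z ∈ Q ∧ ∃ t₀ t₁ : K, t₀ ≠ 0 ∧ t₁ ≠ 0 ∧ z = t₀ • x₀ + t₁ • x₁} := by
  have : FiniteDimensional K E := FiniteDimensional.of_finrank_pos (by omega)
  have hEQ : ∃ z ∈ E, z ≠ 0 ∧ (z ∈ Q ∨ Q = ⊥) := by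
    by_cases h : Q = ⊥
    · have hE' : E ≠ ⊥ := by rintro rfl; simp at hE
      obtain ⟨z, hz, hz0⟩ := Submodule.exists_mem_ne_zero_of_ne_bot hE'
      exact ⟨z, hz, hz0, .inr h⟩
    · obtain ⟨z, hz, hz0⟩ := Submodule.exists_mem_ne_zero_of_ne_bot h
      exact ⟨z, hQ hz, hz0, .inl hz⟩
  obtain ⟨z, hz, hz0, hzQ⟩ := hEQ
  have hzE : Submodule.span K {z} < E := by
    refine lt_of_le_of_ne (by simpa using hz) ?_
    intro h
    rw [← h, finrank_span_singleton hz0] at hE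
    omega
  obtain ⟨u, hu, huz⟩ := SetLike.exists_of_lt hzE
  have hspan : E ≤ Submodule.span K {z - u, u} := by
    have hle : Submodule.span K {z} ≤ Submodule.span K {z - u, u} := by
      rw [Submodule.span_singleton_le_iff_mem, Submodule.mem_span_pair]
      exact ⟨1, 1, by module⟩
    have hlt : Submodule.span K {z} < Submodule.span K {z - u, u} :=
      lt_of_le_of_ne hle fun h => huz (h ▸ Submodule.subset_span (by simp))
    have hle2 : Submodule.span K {z - u, u} ≤ E := by
      rw [Submodule.span_le]
      rintro w (rfl | rfl)
      · exact sub_mem hz hu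
      · exact hu
    have : FiniteDimensional K (Submodule.span K {z - u, u}) :=
      Submodule.finiteDimensional_of_le hle2
    have h1 := Submodule.finrank_lt_finrank_of_lt (K := K) (V := B) (s := Submodule.span K {z})
      (t := Submodule.span K {z - u, u}) hlt
    rw [finrank_span_singleton hz0] at h1
    exact (Submodule.eq_of_le_of_finrank_le hle2 (by omega)).ge
  -- In this basis `z = (z - u) + u` has both coordinates equal to `1`, which settles the case where
  -- `Q` is the line of `z`.
  refine ⟨z - u, sub_mem hz hu, u, hu, hspan, ?_⟩
  rcases hzQ with hzQ | rfl
  · by_cases hQE : Q = E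
    · subst hQE
      exact le_span_general_position (sub_mem hz hu) hu hspan
    · have hlt := Submodule.finrank_lt_finrank_of_lt (lt_of_le_of_ne hQ hQE)
      have hle : Submodule.span K {z} ≤ Q := by simpa using hzQ
      have : FiniteDimensional K Q := Submodule.finiteDimensional_of_le hQ
      have := Submodule.eq_of_le_of_finrank_le hle (by
        rw [finrank_span_singleton hz0]; omega)
      rw [← this]
      refine Submodule.span_mono ?_
      rintro w rfl
      exact ⟨Submodule.mem_span_singleton_self _, 1, 1, one_ne_zero, one_ne_zero, by module⟩
  · exact bot_le

end Hooks

/-! ### `3 × 3` matrices as a row, a column and a `2 × 2` core. -/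

section Core

variable {K : Type*} [Field K] {B C : Type*} [AddCommGroup B] [Module K B] [AddCommGroup C]
  [Module K C]

/-- Contraction of the first factor. -/
noncomputable def rowOf (φ : B →ₗ[K] K) : B ⊗[K] C →ₗ[K] C :=
  (TensorProduct.lid K C).toLinearMap.comp (TensorProduct.map φ .id)

/-- Contraction of the second factor. -/
noncomputable def colOf (ψ : C →ₗ[K] K) : B ⊗[K] C →ₗ[K] B :=
  (TensorProduct.rid K B).toLinearMap.comp (TensorProduct.map .id ψ)

/-- The projection to `ker φ ⊗ ker ψ` along `e` and `f`. -/
noncomputable def coreOf (φ : B →ₗ[K] K) (ψ : C →ₗ[K] K) (e : B) (f : C) :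
    B ⊗[K] C →ₗ[K] B ⊗[K] C :=
  TensorProduct.map (.id - φ.smulRight e) (.id - ψ.smulRight f)

@[simp]
theorem rowOf_tmul (φ : B →ₗ[K] K) (b : B) (c : C) : rowOf φ (b ⊗ₜ[K] c) = φ b • c := by
  simp [rowOf]

@[simp]
theorem colOf_tmul (ψ : C →ₗ[K] K) (b : B) (c : C) : colOf ψ (b ⊗ₜ[K] c) = ψ c • b := by
  simp [colOf]

theorem finrank_map_rowOf (φ : B →ₗ[K] K) (W : Submodule K (B ⊗[K] C)) :
    finrank K (W.map (rowOf φ)) = finrank K (W.map (TensorProduct.map φ (.id : C →ₗ[K] C))) := by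
  rw [rowOf, Submodule.map_comp]
  exact LinearEquiv.finrank_map_eq _ _

theorem finrank_map_colOf (ψ : C →ₗ[K] K) (W : Submodule K (B ⊗[K] C)) :
    finrank K (W.map (colOf ψ)) = finrank K (W.map (TensorProduct.map (.id : B →ₗ[K] B) ψ)) := by
  rw [colOf, Submodule.map_comp]
  exact LinearEquiv.finrank_map_eq _ _

theorem ker_rowOf (φ : B →ₗ[K] K) :
    LinearMap.ker (rowOf φ : B ⊗[K] C →ₗ[K] C) = LinearMap.ker (TensorProduct.map φ .id) :=
  LinearEquiv.ker_comp _ _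

theorem ker_colOf (ψ : C →ₗ[K] K) :
    LinearMap.ker (colOf ψ : B ⊗[K] C →ₗ[K] B) = LinearMap.ker (TensorProduct.map .id ψ) :=
  LinearEquiv.ker_comp _ _

theorem apply_colOf (φ : B →ₗ[K] K) (ψ : C →ₗ[K] K) (w : B ⊗[K] C) :
    φ (colOf ψ w) = ψ (rowOf φ w) := by
  have : φ.comp (colOf ψ) = ψ.comp (rowOf φ) :=
    TensorProduct.ext' fun b c => by simp [mul_comm]
  exact LinearMap.congr_fun this w

theorem apply_rowOf (φ : B →ₗ[K] K) (ψ : C →ₗ[K] K) (w : B ⊗[K] C) :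
    ψ (rowOf φ w) = TensorProduct.lid K K (TensorProduct.map φ ψ w) := by
  have : ψ.comp (rowOf φ) =
      (TensorProduct.lid K K).toLinearMap.comp (TensorProduct.map φ ψ) :=
    TensorProduct.ext' fun b c => by simp
  exact LinearMap.congr_fun this w

/-- The row and the column both contain the corner entry, hence the subtraction. -/
theorem eq_add_coreOf (φ : B →ₗ[K] K) (ψ : C →ₗ[K] K) (e : B) (f : C) (w : B ⊗[K] C) :
    w = e ⊗ₜ rowOf φ w + colOf ψ w ⊗ₜ f - ψ (rowOf φ w) • e ⊗ₜ[K] f + coreOf φ ψ e f w := by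
  have : (LinearMap.id : B ⊗[K] C →ₗ[K] B ⊗[K] C) =
      (TensorProduct.mk K B C e).comp (rowOf φ) + ((TensorProduct.mk K B C).flip f).comp (colOf ψ) -
        (ψ.comp (rowOf φ)).smulRight (e ⊗ₜ[K] f) + coreOf φ ψ e f := by
    refine TensorProduct.ext' fun b c => ?_
    simp only [coreOf, LinearMap.id_apply, LinearMap.add_apply, LinearMap.sub_apply,
      LinearMap.comp_apply, TensorProduct.map_tmul, TensorProduct.sub_tmul, TensorProduct.tmul_sub,
      TensorProduct.mk_apply, LinearMap.flip_apply, LinearMap.smulRight_apply, rowOf_tmul,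
      colOf_tmul, map_smul, TensorProduct.tmul_smul, ← TensorProduct.smul_tmul',
      smul_eq_mul]
    module
  exact LinearMap.congr_fun this w

theorem coreOf_eq_self {φ : B →ₗ[K] K} {ψ : C →ₗ[K] K} {e : B} {f : C} {w : B ⊗[K] C}
    (hr : rowOf φ w = 0) (hc : colOf ψ w = 0) : coreOf φ ψ e f w = w := by
  have h := eq_add_coreOf φ ψ e f w
  rw [hr, hc] at h
  simpa using h.symm

/-- The off-diagonal part of the span of `x₀, x₁` tensor the span of `y₀, y₁`. -/
def offDiagonal (K : Type*) [Field K] {B C : Type*} [AddCommGroup B] [Module K B] [AddCommGroup C]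
    [Module K C] (x₀ x₁ : B) (y₀ y₁ : C) : Submodule K (B ⊗[K] C) :=
  Submodule.span K {x₀ ⊗ₜ y₁, x₁ ⊗ₜ y₀}

variable {φ : B →ₗ[K] K} {ψ : C →ₗ[K] K} {e : B} {f : C} {x₀ x₁ : B} {y₀ y₁ : C}

theorem smul_add_smul_mem_offDiagonal (s t : K) :
    s • x₀ ⊗ₜ[K] y₁ + t • x₁ ⊗ₜ[K] y₀ ∈ offDiagonal K x₀ x₁ y₀ y₁ :=
  Submodule.mem_span_pair.2 ⟨s, t, rfl⟩

theorem offDiagonal_isCoveredBy :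
    IsCoveredBy (simpleTensors K B C) (offDiagonal K x₀ x₁ y₀ y₁) 2 := by
  refine ((IsCoveredBy.singleton (tmul_mem_simpleTensors x₀ y₁)).sup
    (IsCoveredBy.singleton (tmul_mem_simpleTensors x₁ y₀))).mono ?_ le_rfl
  rw [offDiagonal, Submodule.span_insert]

theorem exists_coreOf_sub_mem (he : φ e = 1) (hf : ψ f = 1)
    (hx : LinearMap.ker φ ≤ Submodule.span K {x₀, x₁})
    (hy : LinearMap.ker ψ ≤ Submodule.span K {y₀, y₁}) (w : B ⊗[K] C) :
    ∃ a₀ a₁ : K, coreOf φ ψ e f w - (a₀ • x₀ ⊗ₜ[K] y₀ + a₁ • x₁ ⊗ₜ[K] y₁) ∈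
      offDiagonal K x₀ x₁ y₀ y₁ := by
  induction w using TensorProduct.induction_on with
  | zero => exact ⟨0, 0, by simp⟩
  | add z₁ z₂ h₁ h₂ =>
    obtain ⟨a₀, a₁, h₁⟩ := h₁
    obtain ⟨b₀, b₁, h₂⟩ := h₂
    refine ⟨a₀ + b₀, a₁ + b₁, ?_⟩
    convert add_mem h₁ h₂ using 1
    rw [map_add]
    module
  | tmul b c =>
    obtain ⟨s₀, s₁, hs⟩ := Submodule.mem_span_pair.1 (hx (show b - φ b • e ∈ _ by simp [he]))
    obtain ⟨t₀, t₁, ht⟩ := Submodule.mem_span_pair.1 (hy (show c - ψ c • f ∈ _ by simp [hf]))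
    refine ⟨s₀ * t₀, s₁ * t₁, ?_⟩
    convert smul_add_smul_mem_offDiagonal (s₀ * t₁) (s₁ * t₀) using 1
    simp only [coreOf, TensorProduct.map_tmul, LinearMap.sub_apply, LinearMap.id_apply,
      LinearMap.smulRight_apply, ← hs, ← ht, TensorProduct.add_tmul, TensorProduct.tmul_add,
      TensorProduct.tmul_smul, ← TensorProduct.smul_tmul']
    module

/-- Modulo the off-diagonal part, a tensor of two planes is simple. -/
theorem exists_simple_of_diagonal {z : B ⊗[K] C} {a₀ a₁ : K}
    (hz : z - (a₀ • x₀ ⊗ₜ[K] y₀ + a₁ • x₁ ⊗ₜ[K] y₁) ∈ offDiagonal K x₀ x₁ y₀ y₁) :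
    ∃ s ∈ simpleTensors K B C, z - s ∈ offDiagonal K x₀ x₁ y₀ y₁ := by
  refine ⟨_, tmul_mem_simpleTensors (x₀ + x₁) (a₀ • y₀ + a₁ • y₁), ?_⟩
  convert sub_mem hz (smul_add_smul_mem_offDiagonal a₁ a₀) using 1
  simp only [TensorProduct.add_tmul, TensorProduct.tmul_add, TensorProduct.tmul_smul]
  module

/-- A row with both coordinates nonzero absorbs a diagonal core for free: tilting `e` by `a₀ / t₀`
and `a₁ / t₁` reproduces the diagonal, and the error is off-diagonal. This is why bases in general
position are needed. -/
theorem exists_simple_of_row {z : B ⊗[K] C} {a₀ a₁ t₀ t₁ : K} (e : B)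
    (hz : z - (a₀ • x₀ ⊗ₜ[K] y₀ + a₁ • x₁ ⊗ₜ[K] y₁) ∈ offDiagonal K x₀ x₁ y₀ y₁)
    (h₀ : t₀ ≠ 0) (h₁ : t₁ ≠ 0) :
    ∃ s ∈ simpleTensors K B C,
      e ⊗ₜ (t₀ • y₀ + t₁ • y₁) + z - s ∈ offDiagonal K x₀ x₁ y₀ y₁ := by
  refine ⟨_, tmul_mem_simpleTensors (e + (a₀ / t₀) • x₀ + (a₁ / t₁) • x₁)
    (t₀ • y₀ + t₁ • y₁), ?_⟩
  convert sub_mem hz (smul_add_smul_mem_offDiagonal (a₀ / t₀ * t₁) (a₁ / t₁ * t₀)) using 1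
  simp only [TensorProduct.add_tmul, TensorProduct.tmul_add, TensorProduct.tmul_smul,
    ← TensorProduct.smul_tmul']
  match_scalars <;> field_simp <;> ring

theorem exists_simple_of_col {z : B ⊗[K] C} {a₀ a₁ t₀ t₁ : K} (f : C)
    (hz : z - (a₀ • x₀ ⊗ₜ[K] y₀ + a₁ • x₁ ⊗ₜ[K] y₁) ∈ offDiagonal K x₀ x₁ y₀ y₁)
    (h₀ : t₀ ≠ 0) (h₁ : t₁ ≠ 0) :
    ∃ s ∈ simpleTensors K B C,
      (t₀ • x₀ + t₁ • x₁) ⊗ₜ f + z - s ∈ offDiagonal K x₀ x₁ y₀ y₁ := by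
  refine ⟨_, tmul_mem_simpleTensors (t₀ • x₀ + t₁ • x₁)
    (f + (a₀ / t₀) • y₀ + (a₁ / t₁) • y₁), ?_⟩
  convert sub_mem hz (smul_add_smul_mem_offDiagonal (a₁ / t₁ * t₀) (a₀ / t₀ * t₁)) using 1
  simp only [TensorProduct.add_tmul, TensorProduct.tmul_add, TensorProduct.tmul_smul,
    ← TensorProduct.smul_tmul']
  match_scalars <;> field_simp <;> ring

/-- Gives each row-and-column pattern occurring in `W` a representative in `W` depending linearly on
it, so that differences fall in the core part of `W`. -/
theorem _root_.Submodule.exists_section {T Z : Type*} [AddCommGroup T] [Module K T]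
    [AddCommGroup Z] [Module K Z] (W : Submodule K T) (π : T →ₗ[K] Z) :
    ∃ s : Z →ₗ[K] T, ∀ w ∈ W, s (π w) ∈ W ∧ π (s (π w)) = π w := by
  set g := π.domRestrict W
  obtain ⟨r, hr⟩ := g.rangeRestrict.exists_rightInverse_of_surjective g.range_rangeRestrict
  obtain ⟨s, hs⟩ := LinearMap.exists_extend (W.subtype.comp r)
  refine ⟨s, fun w hw => ?_⟩
  have h1 : s (π w) = r ⟨π w, ⟨⟨w, hw⟩, rfl⟩⟩ :=
    LinearMap.congr_fun hs (⟨π w, ⟨⟨w, hw⟩, rfl⟩⟩ : LinearMap.range g)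
  rw [h1]
  refine ⟨Subtype.coe_prop _, ?_⟩
  exact congrArg Subtype.val (LinearMap.congr_fun hr ⟨π w, ⟨⟨w, hw⟩, rfl⟩⟩)

theorem finrank_ker_functional (hB : finrank K B = 3) {φ : B →ₗ[K] K} (hφ : φ ≠ 0) :
    finrank K (LinearMap.ker φ) = 2 := by
  have : FiniteDimensional K B := FiniteDimensional.of_finrank_pos (by omega)
  have := Module.Dual.finrank_ker_add_one_of_ne_zero hφ
  omega

theorem exists_apply_eq_one {φ : B →ₗ[K] K} (hφ : φ ≠ 0) : ∃ e, φ e = 1 := by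
  obtain ⟨b, hb⟩ := DFunLike.ne_iff.1 hφ
  exact ⟨(φ b)⁻¹ • b, by simpa using inv_mul_cancel₀ hb⟩

/-- A space of `3 × 3` matrices with one entry equal to zero. -/
theorem isCoveredBy_of_le_ker_map_functional [CharZero K] (hB : finrank K B = 3)
    (hC : finrank K C = 3) (hφ : φ ≠ 0) (hψ : ψ ≠ 0) (W : Submodule K (B ⊗[K] C))
    [FiniteDimensional K W] (hW : W ≤ LinearMap.ker (TensorProduct.map φ ψ)) :
    IsCoveredBy (simpleTensors K B C) W
      (finrank K (W.map (TensorProduct.map φ (.id : C →ₗ[K] C))) +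
          finrank K (W.map (TensorProduct.map (.id : B →ₗ[K] B) ψ)) +
          finrank K (W ⊓ LinearMap.ker (TensorProduct.map (.id : B →ₗ[K] B) ψ) ⊓
            LinearMap.ker (TensorProduct.map φ (.id : C →ₗ[K] C)) :
              Submodule K (B ⊗[K] C)) + 2) := by
  rw [← finrank_map_rowOf, ← finrank_map_colOf, ← ker_rowOf, ← ker_colOf]
  obtain ⟨e, he⟩ := exists_apply_eq_one hφ
  obtain ⟨f, hf⟩ := exists_apply_eq_one hψ
  have hzero : ∀ w ∈ W, ψ (rowOf φ w) = 0 := fun w hw => by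
    rw [apply_rowOf, LinearMap.mem_ker.1 (hW hw), map_zero]
  have hP : W.map (rowOf φ) ≤ LinearMap.ker ψ := by
    rintro _ ⟨w, hw, rfl⟩
    exact hzero w hw
  have hQ : W.map (colOf ψ) ≤ LinearMap.ker φ := by
    rintro _ ⟨w, hw, rfl⟩
    rw [LinearMap.mem_ker, apply_colOf]
    exact hzero w hw
  obtain ⟨y₀, -, y₁, -, hy, hPy⟩ :=
    exists_span_pair_general_position (finrank_ker_functional hC hψ) hP
  obtain ⟨x₀, -, x₁, -, hx, hQx⟩ :=
    exists_span_pair_general_position (finrank_ker_functional hB hφ) hQ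
  obtain ⟨s, hs⟩ := W.exists_section ((rowOf φ).prod (colOf ψ))
  set α := (coreOf φ ψ e f).comp s
  -- `g` completes a row, and `h` a column, by the core of its representative. Modulo the core part
  -- `N`, the space `W` lies in `P.map g ⊔ Q.map h`.
  set g := TensorProduct.mk K B C e + α.comp (.inl K C B) with hg
  set h := (TensorProduct.mk K B C).flip f + α.comp (.inr K C B) with hh
  set P := W.map (rowOf φ)
  set Q := W.map (colOf ψ)
  set N : Submodule K (B ⊗[K] C) := W ⊓ LinearMap.ker (colOf ψ) ⊓ LinearMap.ker (rowOf φ) with hN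
  set O := offDiagonal K x₀ x₁ y₀ y₁
  have : FiniteDimensional K N := Submodule.finiteDimensional_of_le (inf_le_left.trans inf_le_left)
  have hdiag : ∀ w, ∃ a₀ a₁ : K, coreOf φ ψ e f w - (a₀ • x₀ ⊗ₜ[K] y₀ + a₁ • x₁ ⊗ₜ[K] y₁) ∈ O :=
    exists_coreOf_sub_mem he hf hx hy
  -- Once the two off-diagonal tensors are in the cover, core elements, completed rows and completed
  -- columns have spanning sets of tensors simple modulo the span built so far. The total is `2 +
  -- dim N + dim P + dim Q`.
  have c1 := offDiagonal_isCoveredBy.sup_span (O := O) (X := N) N Submodule.subset_span le_rfl (by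
    rintro n ⟨⟨-, hc⟩, hr⟩
    obtain ⟨a₀, a₁, ha⟩ := hdiag n
    rw [coreOf_eq_self hr hc] at ha
    exact exists_simple_of_diagonal ha)
  have c2 := c1.sup_span (X := P.map g) (g '' {z | z ∈ P ∧ ∃ t₀ t₁ : K, t₀ ≠ 0 ∧ t₁ ≠ 0 ∧
    z = t₀ • y₀ + t₁ • y₁}) (by rw [← Submodule.map_span]; exact Submodule.map_mono hPy)
    (Set.image_mono fun z hz => hz.1) (by
      rintro _ ⟨_, ⟨-, t₀, t₁, h₀, h₁, rfl⟩, rfl⟩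
      obtain ⟨a₀, a₁, ha⟩ := hdiag (s (t₀ • y₀ + t₁ • y₁, 0))
      obtain ⟨z, hz, hzO⟩ := exists_simple_of_row e ha h₀ h₁
      exact ⟨z, hz, Submodule.mem_sup_left hzO⟩)
  have c3 := c2.sup_span (X := Q.map h) (h '' {z | z ∈ Q ∧ ∃ t₀ t₁ : K, t₀ ≠ 0 ∧ t₁ ≠ 0 ∧
    z = t₀ • x₀ + t₁ • x₁}) (by rw [← Submodule.map_span]; exact Submodule.map_mono hQx)
    (Set.image_mono fun z hz => hz.1) (by
      rintro _ ⟨_, ⟨-, t₀, t₁, h₀, h₁, rfl⟩, rfl⟩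
      obtain ⟨a₀, a₁, ha⟩ := hdiag (s (0, t₀ • x₀ + t₁ • x₁))
      obtain ⟨z, hz, hzO⟩ := exists_simple_of_col f ha h₀ h₁
      exact ⟨z, hz, Submodule.mem_sup_left (Submodule.mem_sup_left hzO)⟩)
  refine c3.mono ?_ ?_
  · intro w hw
    obtain ⟨hsW, hsπ⟩ := hs w hw
    have hr : rowOf φ (w - s (rowOf φ w, colOf ψ w)) = 0 := by
      rw [map_sub, sub_eq_zero]; exact (congrArg Prod.fst hsπ).symm
    have hc : colOf ψ (w - s (rowOf φ w, colOf ψ w)) = 0 := by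
      rw [map_sub, sub_eq_zero]; exact (congrArg Prod.snd hsπ).symm
    have hcore := coreOf_eq_self (e := e) (f := f) hr hc
    have hα : coreOf φ ψ e f w = (w - s (rowOf φ w, colOf ψ w)) +
        (α (rowOf φ w, 0) + α (0, colOf ψ w)) := by
      rw [← map_add, Prod.mk_add_mk, add_zero, zero_add, ← hcore, map_sub]
      simp [α]
    have key : w = (w - s (rowOf φ w, colOf ψ w)) + g (rowOf φ w) + h (colOf ψ w) := by
      conv_lhs => rw [eq_add_coreOf φ ψ e f w, hzero w hw, hα]
      simp only [hg, hh, LinearMap.add_apply, TensorProduct.mk_apply, LinearMap.comp_apply,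
        LinearMap.inl_apply, LinearMap.inr_apply, LinearMap.flip_apply]
      module
    rw [key]
    refine Submodule.add_mem_sup (Submodule.add_mem_sup (Submodule.mem_sup_right ?_)
      ⟨_, ⟨w, hw, rfl⟩, rfl⟩) ⟨_, ⟨w, hw, rfl⟩, rfl⟩
    exact ⟨⟨sub_mem hw hsW, hc⟩, hr⟩
  · have h1 := Submodule.finrank_map_le g P
    have h2 := Submodule.finrank_map_le h Q
    omega

/-- A space of `3 × 3` matrices whose intersection with the tensors of two planes is
off-diagonal. -/
theorem isCoveredBy_seven [CharZero K] (he : φ e = 1) (hf : ψ f = 1)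
    (hx₀ : φ x₀ = 0) (hx₁ : φ x₁ = 0) (hy₀ : ψ y₀ = 0) (hy₁ : ψ y₁ = 0)
    (hx : LinearMap.ker φ ≤ Submodule.span K {x₀, x₁})
    (hy : LinearMap.ker ψ ≤ Submodule.span K {y₀, y₁}) (W : Submodule K (B ⊗[K] C))
    (hW : ∀ w ∈ W, rowOf φ w = 0 → colOf ψ w = 0 → w ∈ offDiagonal K x₀ x₁ y₀ y₁) :
    IsCoveredBy (simpleTensors K B C) W 7 := by
  obtain ⟨s, hs⟩ := W.exists_section ((rowOf φ).prod (colOf ψ))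
  set α := (coreOf φ ψ e f).comp s with hα
  set g := TensorProduct.mk K B C e + α.comp (.inl K C B) with hg
  set h := (TensorProduct.mk K B C).flip f + α.comp (.inr K C B) with hh
  set O := offDiagonal K x₀ x₁ y₀ y₁ with hO
  set F := LinearMap.ker ψ with hF
  set E := LinearMap.ker φ with hE
  have hF2 : FiniteDimensional K F ∧ finrank K F ≤ 2 := by
    classical
    have hfd : FiniteDimensional K (Submodule.span K {y₀, y₁}) :=
      FiniteDimensional.span_of_finite K (by simp)
    refine ⟨Submodule.finiteDimensional_of_le hy, (Submodule.finrank_mono hy).trans ?_⟩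
    have := finrank_span_finset_le_card (R := K) ({y₀, y₁} : Finset C)
    rw [Finset.coe_pair] at this
    exact this.trans Finset.card_le_two
  have hE2 : FiniteDimensional K E ∧ finrank K E ≤ 2 := by
    classical
    have hfd : FiniteDimensional K (Submodule.span K {x₀, x₁}) :=
      FiniteDimensional.span_of_finite K (by simp)
    refine ⟨Submodule.finiteDimensional_of_le hx, (Submodule.finrank_mono hx).trans ?_⟩
    have := finrank_span_finset_le_card (R := K) ({x₀, x₁} : Finset B)
    rw [Finset.coe_pair] at this
    exact this.trans Finset.card_le_two
  have := hF2.1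
  have := hE2.1
  have hdiag : ∀ z, ∃ a₀ a₁ : K, α z - (a₀ • x₀ ⊗ₜ[K] y₀ + a₁ • x₁ ⊗ₜ[K] y₁) ∈ O :=
    fun z => exists_coreOf_sub_mem he hf hx hy _
  have c2 := (offDiagonal_isCoveredBy (x₀ := x₀) (x₁ := x₁) (y₀ := y₀) (y₁ := y₁)).sup_span
    (O := O) (X := F.map g) (g '' {z | z ∈ F ∧ ∃ t₀ t₁ : K, t₀ ≠ 0 ∧ t₁ ≠ 0 ∧
    z = t₀ • y₀ + t₁ • y₁}) (by
      rw [← Submodule.map_span]; exact Submodule.map_mono (le_span_general_position hy₀ hy₁ hy))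
    (Set.image_mono fun z hz => hz.1) (by
      rintro _ ⟨_, ⟨-, t₀, t₁, h₀, h₁, rfl⟩, rfl⟩
      obtain ⟨a₀, a₁, ha⟩ := hdiag (t₀ • y₀ + t₁ • y₁, 0)
      exact exists_simple_of_row e ha h₀ h₁)
  have c3 := c2.sup_span (X := E.map h) (h '' {z | z ∈ E ∧ ∃ t₀ t₁ : K, t₀ ≠ 0 ∧ t₁ ≠ 0 ∧
    z = t₀ • x₀ + t₁ • x₁}) (by
      rw [← Submodule.map_span]; exact Submodule.map_mono (le_span_general_position hx₀ hx₁ hx))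
    (Set.image_mono fun z hz => hz.1) (by
      rintro _ ⟨_, ⟨-, t₀, t₁, h₀, h₁, rfl⟩, rfl⟩
      obtain ⟨a₀, a₁, ha⟩ := hdiag (0, t₀ • x₀ + t₁ • x₁)
      obtain ⟨z, hz, hzO⟩ := exists_simple_of_col f ha h₀ h₁
      exact ⟨z, hz, Submodule.mem_sup_left hzO⟩)
  -- The corner entry is not assumed to vanish, so a single completed corner matrix is added. The
  -- count is `2 + 2 + 2 + 1`.
  set k := e ⊗ₜ f + α (f, e) with hk
  have hsimple : ∃ z ∈ simpleTensors K B C, k - z ∈ O ⊔ F.map g ⊔ E.map h := by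
    obtain ⟨a₀₀, a₁₀, hu₀⟩ := hdiag (y₀, 0)
    obtain ⟨a₀₁, a₁₁, hu₁⟩ := hdiag (y₁, 0)
    obtain ⟨b₀₀, b₁₀, hv₀⟩ := hdiag (0, x₀)
    obtain ⟨b₀₁, b₁₁, hv₁⟩ := hdiag (0, x₁)
    obtain ⟨c₀, c₁, hw⟩ := hdiag (f, e)
    -- Making `k + g η + h ξ` equal to `(e + ξ) ⊗ (f + η)` modulo `O` amounts to two diagonal
    -- equations, linear in `η` for fixed `ξ`, with matrix `(ξ₀ - a₀₀, -a₀₁; -a₁₀, ξ₁ - a₁₁)`. This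
    -- choice of `ξ` makes its determinant `1`, and `η₀`, `η₁` come from the inverse matrix.
    set ξ₀ := a₀₀ + 1 with hξ₀
    set ξ₁ := a₁₁ + 1 + a₀₁ * a₁₀ with hξ₁
    set d₀ := b₀₀ * ξ₀ + b₀₁ * ξ₁ + c₀ with hd₀
    set d₁ := b₁₀ * ξ₀ + b₁₁ * ξ₁ + c₁ with hd₁
    set η₀ := (1 + a₀₁ * a₁₀) * d₀ + a₀₁ * d₁ with hη₀
    set η₁ := a₁₀ * d₀ + d₁ with hη₁
    refine ⟨_, tmul_mem_simpleTensors (e + (ξ₀ • x₀ + ξ₁ • x₁)) (f + (η₀ • y₀ + η₁ • y₁)), ?_⟩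
    have m1 : g (η₀ • y₀ + η₁ • y₁) ∈ F.map g :=
      ⟨_, by simp [hF, hy₀, hy₁], rfl⟩
    have m2 : h (ξ₀ • x₀ + ξ₁ • x₁) ∈ E.map h :=
      ⟨_, by simp [hE, hx₀, hx₁], rfl⟩
    have hgα : g (η₀ • y₀ + η₁ • y₁) = e ⊗ₜ (η₀ • y₀ + η₁ • y₁) +
        (η₀ • α (y₀, 0) + η₁ • α (y₁, 0)) := by
      simp only [hg, LinearMap.add_apply, TensorProduct.mk_apply, LinearMap.comp_apply,
        map_add, map_smul, LinearMap.inl_apply, TensorProduct.tmul_add, TensorProduct.tmul_smul]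
      module
    have hhα : h (ξ₀ • x₀ + ξ₁ • x₁) = (ξ₀ • x₀ + ξ₁ • x₁) ⊗ₜ f +
        (ξ₀ • α (0, x₀) + ξ₁ • α (0, x₁)) := by
      simp only [hh, LinearMap.add_apply, TensorProduct.mk_apply, LinearMap.comp_apply,
        map_add, map_smul, LinearMap.inr_apply, LinearMap.flip_apply, TensorProduct.add_tmul,
        ← TensorProduct.smul_tmul']
      module
    have m3 : k + g (η₀ • y₀ + η₁ • y₁) + h (ξ₀ • x₀ + ξ₁ • x₁) -
        (e + (ξ₀ • x₀ + ξ₁ • x₁)) ⊗ₜ[K] (f + (η₀ • y₀ + η₁ • y₁)) ∈ O := by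
      have := sub_mem (add_mem (add_mem (add_mem (Submodule.smul_mem _ η₀ hu₀)
        (Submodule.smul_mem _ η₁ hu₁)) (add_mem (Submodule.smul_mem _ ξ₀ hv₀)
        (Submodule.smul_mem _ ξ₁ hv₁))) hw)
        (smul_add_smul_mem_offDiagonal (x₀ := x₀) (x₁ := x₁) (y₀ := y₀) (y₁ := y₁)
          (ξ₀ * η₁) (ξ₁ * η₀))
      convert this using 1
      rw [hgα, hhα, hk]
      simp only [TensorProduct.add_tmul, TensorProduct.tmul_add,
        TensorProduct.tmul_smul, ← TensorProduct.smul_tmul']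
      have q₀ : ξ₀ * η₀ = a₀₀ * η₀ + a₀₁ * η₁ + d₀ := by
        rw [hξ₀, hη₀, hη₁]; ring
      have q₁ : ξ₁ * η₁ = a₁₀ * η₀ + a₁₁ * η₁ + d₁ := by
        rw [hξ₁, hη₀, hη₁]; ring
      rw [hd₀] at q₀
      rw [hd₁] at q₁
      linear_combination (norm := module) -q₀ • x₀ ⊗ₜ[K] y₀ - q₁ • x₁ ⊗ₜ[K] y₁
    have := sub_mem (sub_mem (Submodule.mem_sup_left (Submodule.mem_sup_left m3) :
      _ ∈ O ⊔ F.map g ⊔ E.map h) (Submodule.mem_sup_left (Submodule.mem_sup_right m1)))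
      (Submodule.mem_sup_right m2)
    convert this using 1
    abel
  have c4 := c3.sup_span (X := Submodule.span K {k}) {k} le_rfl (by simp) (by
    rintro _ rfl
    exact hsimple)
  refine c4.mono ?_ ?_
  · intro w hw
    obtain ⟨hsW, hsπ⟩ := hs w hw
    have hr : rowOf φ (w - s (rowOf φ w, colOf ψ w)) = 0 := by
      rw [map_sub, sub_eq_zero]; exact (congrArg Prod.fst hsπ).symm
    have hc : colOf ψ (w - s (rowOf φ w, colOf ψ w)) = 0 := by
      rw [map_sub, sub_eq_zero]; exact (congrArg Prod.snd hsπ).symm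
    have hcore := coreOf_eq_self (e := e) (f := f) hr hc
    set z := ψ (rowOf φ w) with hz
    have hαw : coreOf φ ψ e f w = (w - s (rowOf φ w, colOf ψ w)) +
        (α (rowOf φ w - z • f, 0) + α (0, colOf ψ w - z • e) + z • α (f, e)) := by
      rw [← map_smul, ← map_add, ← map_add, ← hcore, map_sub]
      simp [α]
    -- Subtracting the corner entry `z` moves the row into `ker ψ` and the column into `ker φ`, the
    -- domains where `g` and `h` are covered.
    have key : w = (w - s (rowOf φ w, colOf ψ w)) + g (rowOf φ w - z • f) +
        h (colOf ψ w - z • e) + z • k := by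
      conv_lhs => rw [eq_add_coreOf φ ψ e f w, hαw]
      simp only [hg, hh, hk, LinearMap.add_apply, TensorProduct.mk_apply, LinearMap.comp_apply,
        LinearMap.inl_apply, LinearMap.inr_apply, LinearMap.flip_apply, TensorProduct.tmul_sub,
        TensorProduct.sub_tmul, TensorProduct.tmul_smul, ← TensorProduct.smul_tmul', smul_add]
      abel
    rw [key]
    refine Submodule.add_mem_sup (Submodule.add_mem_sup (Submodule.add_mem_sup ?_
      ⟨_, ?_, rfl⟩) ⟨_, ?_, rfl⟩) (Submodule.smul_mem _ _ (Submodule.mem_span_singleton_self k))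
    · exact hW _ (sub_mem hw hsW) hr hc
    · simp [hF, hf, hz]
    · simp [hE, he, hz, apply_colOf]
  · have h1 := Submodule.finrank_map_le g F
    have h2 := Submodule.finrank_map_le h E
    have h3 : finrank K (Submodule.span K {k}) ≤ 1 := by
      have := finrank_span_finset_le_card (R := K) ({k} : Finset (B ⊗[K] C))
      rwa [Finset.coe_singleton, Finset.card_singleton] at this
    omega

end Core

/-! ### Eigenvectors in odd dimension over `ℝ` and `ℂ`. -/

section Roots

open Polynomial in
theorem _root_.Real.exists_isRoot_of_odd_natDegree {p : ℝ[X]} (hp : p.Monic)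
    (hodd : Odd p.natDegree) : ∃ x, p.IsRoot x := by
  have hdeg : ∀ q : ℝ[X], q.natDegree = p.natDegree → 0 < q.degree := fun q hq =>
    natDegree_pos_iff_degree_pos.1 (hq ▸ hodd.pos)
  have htop : Filter.Tendsto (fun x => p.eval x) Filter.atTop Filter.atTop :=
    p.tendsto_atTop_of_leadingCoeff_nonneg (hdeg p rfl) (by simp [hp.leadingCoeff])
  have hbot : Filter.Tendsto (fun x => p.eval x) Filter.atBot Filter.atBot := by
    have h1 : (-(p.comp (-X))).natDegree = p.natDegree := by simp [natDegree_comp]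
    have h2 : (-(p.comp (-X))).leadingCoeff = 1 := by
      rw [leadingCoeff_neg, leadingCoeff_comp (by simp), hp.leadingCoeff]
      simp [hodd.neg_one_pow]
    have h3 := (-(p.comp (-X))).tendsto_atTop_of_leadingCoeff_nonneg (hdeg _ h1) (by simp [h2])
    have h4 := Filter.tendsto_neg_atTop_atBot.comp (h3.comp Filter.tendsto_neg_atBot_atTop)
    refine h4.congr fun x => ?_
    simp
  exact (p.continuous.surjective htop hbot) 0

open Polynomial in
theorem _root_.RCLike.exists_isRoot_of_odd_natDegree {𝕜 : Type*} [RCLike 𝕜] {p : 𝕜[X]}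
    (hp : p.Monic) (hodd : Odd p.natDegree) : ∃ x, p.IsRoot x := by
  have key : ∀ {F : Type} [Field F] (e : 𝕜 ≃+* F), (∃ x, (p.map (e : 𝕜 →+* F)).IsRoot x) →
      ∃ x, p.IsRoot x := by
    rintro F _ e ⟨x, hx⟩
    refine ⟨e.symm x, ?_⟩
    have := hx.map (f := (e.symm : F →+* 𝕜))
    rw [map_map] at this
    simpa using this
  rcases RCLike.I_eq_zero_or_im_I_eq_one (K := 𝕜) with h | h
  · exact key (RCLike.realRingEquiv h) (Real.exists_isRoot_of_odd_natDegree (hp.map _)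
      (by rwa [hp.natDegree_map]))
  · refine key (RCLike.complexRingEquiv h) (IsAlgClosed.exists_root _ ?_)
    rw [hp.degree_map]
    exact (natDegree_pos_iff_degree_pos.1 hodd.pos).ne'

theorem exists_apply_eq_smul_of_odd_finrank {𝕜 C : Type*} [RCLike 𝕜] [AddCommGroup C]
    [Module 𝕜 C] (hC : Odd (finrank 𝕜 C)) (f : C →ₗ[𝕜] C) : ∃ (μ : 𝕜) (v : C), v ≠ 0 ∧ f v = μ • v := by
  have : FiniteDimensional 𝕜 C := FiniteDimensional.of_finrank_pos hC.pos
  obtain ⟨μ, hμ⟩ := RCLike.exists_isRoot_of_odd_natDegree f.charpoly_monic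
    (by rwa [f.charpoly_natDegree])
  obtain ⟨v, hv⟩ := ((Module.End.hasEigenvalue_iff_isRoot_charpoly f μ).2 hμ).exists_hasEigenvector
  exact ⟨μ, v, hv.2, hv.apply_eq_smul⟩

end Roots

/-! ### Singular `3 × 3` matrices and covers of three-dimensional spaces. -/

section Singular

variable {K : Type*} [Field K] {B C : Type*} [AddCommGroup B] [Module K B] [AddCommGroup C]
  [Module K C]

/-- A tensor as a linear map from the dual of the first factor to the second. -/
noncomputable def rowHom : B ⊗[K] C →ₗ[K] Dual K B →ₗ[K] C :=
  (dualTensorHom K (Dual K B) C).comp (TensorProduct.map (Dual.eval K B) .id)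

theorem rowHom_apply (X : B ⊗[K] C) (φ : Dual K B) : rowHom X φ = rowOf φ X := by
  induction X using TensorProduct.induction_on with
  | zero => simp
  | add x y hx hy => rw [map_add, LinearMap.add_apply, hx, hy, map_add]
  | tmul b c => simp [rowHom]

/-- The tensor `X` has a nontrivial left kernel. -/
def IsSingular (X : B ⊗[K] C) : Prop := ∃ φ : Dual K B, φ ≠ 0 ∧ rowOf φ X = 0

theorem exists_map_eq_add {g : B →ₗ[K] B} {x₀ x₁ : B} (hg : ∀ b, g b ∈ Submodule.span K {x₀, x₁})
    (z : B ⊗[K] C) : ∃ c₀ c₁ : C, TensorProduct.map g .id z = x₀ ⊗ₜ[K] c₀ + x₁ ⊗ₜ[K] c₁ := by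
  induction z using TensorProduct.induction_on with
  | zero => exact ⟨0, 0, by simp⟩
  | add z₁ z₂ h₁ h₂ =>
    obtain ⟨c₀, c₁, h₁⟩ := h₁
    obtain ⟨d₀, d₁, h₂⟩ := h₂
    refine ⟨c₀ + d₀, c₁ + d₁, ?_⟩
    rw [map_add, h₁, h₂, TensorProduct.tmul_add, TensorProduct.tmul_add]
    abel
  | tmul b c =>
    obtain ⟨s, t, h⟩ := Submodule.mem_span_pair.1 (hg b)
    refine ⟨s • c, t • c, ?_⟩
    rw [TensorProduct.map_tmul, ← h, TensorProduct.add_tmul, TensorProduct.smul_tmul,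
      TensorProduct.smul_tmul]
    rfl

theorem exists_eq_add_of_rowOf_eq_zero {φ : B →ₗ[K] K} {e x₀ x₁ : B} (he : φ e = 1)
    (hx : LinearMap.ker φ ≤ Submodule.span K {x₀, x₁}) {X : B ⊗[K] C} (hX : rowOf φ X = 0) :
    ∃ c₀ c₁ : C, X = x₀ ⊗ₜ[K] c₀ + x₁ ⊗ₜ[K] c₁ := by
  obtain ⟨c₀, c₁, h⟩ := exists_map_eq_add (C := C) (g := .id - φ.smulRight e)
    (fun b => hx (by simp [he])) X
  refine ⟨c₀, c₁, ?_⟩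
  rw [← h]
  have : TensorProduct.map (.id - φ.smulRight e) .id =
      (LinearMap.id : B ⊗[K] C →ₗ[K] B ⊗[K] C) - (TensorProduct.mk K B C e).comp (rowOf φ) :=
    TensorProduct.ext' fun b c => by simp [TensorProduct.sub_tmul, TensorProduct.smul_tmul]
  rw [this]
  simp [hX]

theorem IsSingular.exists_eq_add (hB : finrank K B = 3) {X : B ⊗[K] C} (hX : IsSingular X) :
    ∃ (x₀ x₁ : B) (c₀ c₁ : C), X = x₀ ⊗ₜ[K] c₀ + x₁ ⊗ₜ[K] c₁ := by
  obtain ⟨φ, hφ, hX⟩ := hX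
  obtain ⟨e, he⟩ := exists_apply_eq_one hφ
  have : FiniteDimensional K (LinearMap.ker φ) :=
    FiniteDimensional.of_finrank_pos (by rw [finrank_ker_functional hB hφ]; omega)
  let b := finBasisOfFinrankEq K _ (finrank_ker_functional hB hφ)
  obtain ⟨c₀, c₁, h⟩ := exists_eq_add_of_rowOf_eq_zero (x₀ := (b 0 : B)) (x₁ := (b 1 : B)) he (by
    intro v hv
    have h := congrArg Subtype.val (b.sum_repr ⟨v, hv⟩)
    rw [Fin.sum_univ_two] at h
    exact Submodule.mem_span_pair.2 ⟨_, _, h⟩) hX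
  exact ⟨_, _, c₀, c₁, h⟩

theorem IsCoveredBy.of_eq_add {X s t : B ⊗[K] C} {m n : ℕ} (h : X = s + t)
    (hs : IsCoveredBy (simpleTensors K B C) (Submodule.span K {s}) m)
    (ht : IsCoveredBy (simpleTensors K B C) (Submodule.span K {t}) n) :
    IsCoveredBy (simpleTensors K B C) (Submodule.span K {X}) (m + n) := by
  refine (hs.sup ht).mono ?_ le_rfl
  rw [Submodule.span_singleton_le_iff_mem, h]
  exact Submodule.add_mem_sup (Submodule.mem_span_singleton_self _)
    (Submodule.mem_span_singleton_self _)

theorem IsSingular.isCoveredBy (hB : finrank K B = 3) {X : B ⊗[K] C} (hX : IsSingular X) :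
    IsCoveredBy (simpleTensors K B C) (Submodule.span K {X}) 2 := by
  obtain ⟨x₀, x₁, c₀, c₁, h⟩ := hX.exists_eq_add hB
  exact IsCoveredBy.of_eq_add h (.singleton (tmul_mem_simpleTensors _ _))
    (.singleton (tmul_mem_simpleTensors _ _))

theorem eq_sum_basis_tmul {ι : Type*} [Fintype ι] (b : Basis ι K B) (X : B ⊗[K] C) :
    X = ∑ i, b i ⊗ₜ[K] rowOf (b.coord i) X := by
  have : (LinearMap.id : B ⊗[K] C →ₗ[K] B ⊗[K] C) =
      ∑ i, (TensorProduct.mk K B C (b i)).comp (rowOf (b.coord i)) := by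
    refine TensorProduct.ext' fun x c => ?_
    simp only [LinearMap.id_apply, LinearMap.sum_apply, LinearMap.comp_apply, rowOf_tmul,
      TensorProduct.mk_apply, Basis.coord_apply, ← TensorProduct.smul_tmul, ← TensorProduct.sum_tmul,
      Basis.sum_repr]
  simpa using LinearMap.congr_fun this X

theorem eq_sum_tmul_basis {ι : Type*} [Fintype ι] (c : Basis ι K C) (X : B ⊗[K] C) :
    X = ∑ i, colOf (c.coord i) X ⊗ₜ[K] c i := by
  have : (LinearMap.id : B ⊗[K] C →ₗ[K] B ⊗[K] C) =
      ∑ i, ((TensorProduct.mk K B C).flip (c i)).comp (colOf (c.coord i)) := by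
    refine TensorProduct.ext' fun x y => ?_
    simp only [LinearMap.id_apply, LinearMap.sum_apply, LinearMap.comp_apply, colOf_tmul,
      TensorProduct.mk_apply, Basis.coord_apply, LinearMap.flip_apply, TensorProduct.smul_tmul,
      ← TensorProduct.tmul_sum, Basis.sum_repr]
  simpa using LinearMap.congr_fun this X

theorem isCoveredBy_three (hB : finrank K B = 3) (X : B ⊗[K] C) :
    IsCoveredBy (simpleTensors K B C) (Submodule.span K {X}) 3 := by
  have : FiniteDimensional K B := FiniteDimensional.of_finrank_pos (by omega)
  have h := eq_sum_basis_tmul (finBasisOfFinrankEq K B hB) X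
  rw [Fin.sum_univ_three] at h
  exact .of_eq_add h (.of_eq_add rfl (.singleton (tmul_mem_simpleTensors _ _))
    (.singleton (tmul_mem_simpleTensors _ _))) (.singleton (tmul_mem_simpleTensors _ _))

theorem exists_rowHom_equiv (hB : finrank K B = 3) (hC : finrank K C = 3) {Y : B ⊗[K] C}
    (hY : ¬ IsSingular Y) : ∃ L : Dual K B ≃ₗ[K] C, ∀ φ, L φ = rowOf φ Y := by
  have : FiniteDimensional K B := FiniteDimensional.of_finrank_pos (by omega)
  have : FiniteDimensional K C := FiniteDimensional.of_finrank_pos (by omega)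
  have hinj : Function.Injective (rowHom Y) := by
    rw [← LinearMap.ker_eq_bot, LinearMap.ker_eq_bot']
    intro φ hφ
    by_contra h
    exact hY ⟨φ, h, by rwa [← rowHom_apply]⟩
  refine ⟨(rowHom Y).linearEquivOfInjective hinj (by rw [Subspace.dual_finrank_eq, hB, hC]),
    fun φ => ?_⟩
  rw [LinearMap.linearEquivOfInjective_apply, rowHom_apply]

theorem mem_simpleTensors_of_right {x₀ x₁ : B} {c₀ c₁ : C}
    (h : ¬ LinearIndependent K ![c₀, c₁]) : x₀ ⊗ₜ[K] c₀ + x₁ ⊗ₜ c₁ ∈ simpleTensors K B C := by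
  by_cases hc : c₀ = 0
  · exact ⟨x₁, c₁, by simp [hc]⟩
  · rw [LinearIndependent.pair_iff' hc] at h
    push Not at h
    obtain ⟨a, rfl⟩ := h
    exact ⟨x₀ + a • x₁, c₀, by rw [TensorProduct.add_tmul, TensorProduct.smul_tmul]⟩

theorem mem_simpleTensors_of_left {x₀ x₁ : B} {c₀ c₁ : C}
    (h : ¬ LinearIndependent K ![x₀, x₁]) : x₀ ⊗ₜ[K] c₀ + x₁ ⊗ₜ c₁ ∈ simpleTensors K B C := by
  by_cases hc : x₀ = 0
  · exact ⟨x₁, c₁, by simp [hc]⟩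
  · rw [LinearIndependent.pair_iff' hc] at h
    push Not at h
    obtain ⟨a, rfl⟩ := h
    exact ⟨x₀, c₀ + a • c₁, by rw [TensorProduct.tmul_add, ← TensorProduct.smul_tmul]⟩

/-- One simple summand of `X` does double duty: subtracting a multiple of it makes `Y` singular,
with `φ` in the left kernel. The cost is two for `X`, two for `Z` and two for the corrected `Y`. -/
theorem isCoveredBy_six_of_apply_ne_zero (hB : finrank K B = 3) {X Y Z t : B ⊗[K] C} {x : B}
    {φ : Dual K B} (hX : X = x ⊗ₜ rowOf φ Y + t) (ht : t ∈ simpleTensors K B C)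
    (hφ : φ x ≠ 0) (hZ : IsSingular Z) :
    IsCoveredBy (simpleTensors K B C) (Submodule.span K {X} ⊔
      (Submodule.span K {Z} ⊔ Submodule.span K {Y})) 6 := by
  have hsing : IsSingular (Y - (φ x)⁻¹ • x ⊗ₜ[K] rowOf φ Y) :=
    ⟨φ, fun h => hφ (by simp [h]), by
      rw [map_sub, map_smul, rowOf_tmul, inv_smul_smul₀ hφ, sub_self]⟩
  set s := x ⊗ₜ[K] rowOf φ Y with hs
  set Y' := Y - (φ x)⁻¹ • s with hY'
  have hss : s ∈ simpleTensors K B C := tmul_mem_simpleTensors _ _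
  refine (((IsCoveredBy.singleton hss).sup (IsCoveredBy.singleton ht)).sup
    ((hZ.isCoveredBy hB).sup (hsing.isCoveredBy hB))).mono ?_ le_rfl
  have m1 : s ∈ Submodule.span K {s} ⊔ Submodule.span K {t} ⊔
      (Submodule.span K {Z} ⊔ Submodule.span K {Y'}) :=
    Submodule.mem_sup_left (Submodule.mem_sup_left (Submodule.mem_span_singleton_self _))
  have m2 : t ∈ Submodule.span K {s} ⊔ Submodule.span K {t} ⊔
      (Submodule.span K {Z} ⊔ Submodule.span K {Y'}) :=
    Submodule.mem_sup_left (Submodule.mem_sup_right (Submodule.mem_span_singleton_self _))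
  have m3 : Z ∈ Submodule.span K {s} ⊔ Submodule.span K {t} ⊔
      (Submodule.span K {Z} ⊔ Submodule.span K {Y'}) :=
    Submodule.mem_sup_right (Submodule.mem_sup_left (Submodule.mem_span_singleton_self _))
  have m4 : Y' ∈ Submodule.span K {s} ⊔ Submodule.span K {t} ⊔
      (Submodule.span K {Z} ⊔ Submodule.span K {Y'}) :=
    Submodule.mem_sup_right (Submodule.mem_sup_right (Submodule.mem_span_singleton_self _))
  refine sup_le ?_ (sup_le ?_ ?_) <;> rw [Submodule.span_singleton_le_iff_mem]
  · rw [hX]; exact add_mem m1 m2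
  · exact m3
  · have := add_mem m4 (Submodule.smul_mem _ (φ x)⁻¹ m1)
    rwa [hY', sub_add_cancel] at this

theorem isCoveredBy_six_of_isSingular (hB : finrank K B = 3) (hC : finrank K C = 3)
    {X Y Z : B ⊗[K] C} (hX : IsSingular X) (hZ : IsSingular Z) :
    IsCoveredBy (simpleTensors K B C) (Submodule.span K {X} ⊔
      (Submodule.span K {Z} ⊔ Submodule.span K {Y})) 6 := by
  have : FiniteDimensional K B := FiniteDimensional.of_finrank_pos (by omega)
  by_cases hY : IsSingular Y
  · exact (hX.isCoveredBy hB).sup ((hZ.isCoveredBy hB).sup (hY.isCoveredBy hB))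
  obtain ⟨x₀, x₁, c₀, c₁, hXe⟩ := hX.exists_eq_add hB
  by_cases hs : X ∈ simpleTensors K B C
  · exact (IsCoveredBy.singleton hs).sup ((hZ.isCoveredBy hB).sup (isCoveredBy_three hB Y))
  obtain ⟨L, hL⟩ := exists_rowHom_equiv hB hC hY
  have hr : ∀ c, rowOf (L.symm c) Y = c := fun c => by rw [← hL, L.apply_symm_apply]
  -- It remains to write `X = x ⊗ c + t` with `t` simple and `L.symm c x ≠ 0`. The four pairings of
  -- `c₀, c₁` with `x₀, x₁` are tried; for the mixed ones `X` is rewritten using `x₀ + x₁`.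
  have split : ∀ (x : B) (c : C) (t : B ⊗[K] C), X = x ⊗ₜ c + t → t ∈ simpleTensors K B C →
      L.symm c x ≠ 0 → IsCoveredBy (simpleTensors K B C) (Submodule.span K {X} ⊔
      (Submodule.span K {Z} ⊔ Submodule.span K {Y})) 6 := fun x c t h ht hx =>
    isCoveredBy_six_of_apply_ne_zero hB (by rw [hr]; exact h) ht hx hZ
  by_cases h00 : L.symm c₀ x₀ = 0
  swap
  · exact split _ _ _ hXe (tmul_mem_simpleTensors _ _) h00
  by_cases h11 : L.symm c₁ x₁ = 0
  swap
  · exact split _ _ _ (hXe.trans (add_comm _ _)) (tmul_mem_simpleTensors _ _) h11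
  by_cases h01 : L.symm c₀ x₁ = 0
  swap
  · refine split (x₀ + x₁) c₀ _ ?_ (tmul_mem_simpleTensors x₁ (c₁ - c₀)) (by simpa [h00])
    rw [hXe, TensorProduct.add_tmul, TensorProduct.tmul_sub]; abel
  by_cases h10 : L.symm c₁ x₀ = 0
  swap
  · refine split (x₀ + x₁) c₁ _ ?_ (tmul_mem_simpleTensors x₀ (c₀ - c₁)) (by simpa [h11])
    rw [hXe, TensorProduct.add_tmul, TensorProduct.tmul_sub]; abel
  exfalso
  have hx : LinearIndependent K ![x₀, x₁] := by
    by_contra h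
    exact hs (hXe ▸ mem_simpleTensors_of_left h)
  have hc : LinearIndependent K ![c₀, c₁] := by
    by_contra h
    exact hs (hXe ▸ mem_simpleTensors_of_right h)
  have hφ := hc.map' L.symm.toLinearMap L.symm.ker
  have e1 := finrank_span_eq_card hx
  have e2 := finrank_span_eq_card hφ
  -- If all four pairings vanish, a plane of functionals annihilates a plane in a three-dimensional
  -- space, whose annihilator is only a line.
  have hle : Submodule.span K (Set.range (L.symm.toLinearMap ∘ ![c₀, c₁])) ≤
      (Submodule.span K (Set.range ![x₀, x₁])).dualAnnihilator := by
    rw [Submodule.span_le]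
    rintro _ ⟨i, rfl⟩
    rw [SetLike.mem_coe, Submodule.mem_dualAnnihilator]
    intro w hw
    refine Submodule.span_induction ?_ (map_zero _) (fun a b _ _ ha hb => by rw [map_add, ha, hb, add_zero])
      (fun r a _ ha => by rw [map_smul, ha, smul_zero]) hw
    rintro _ ⟨j, rfl⟩
    fin_cases i <;> fin_cases j <;> simp [h00, h01, h10, h11]
  have e3 := Submodule.finrank_mono hle
  have e4 := Subspace.finrank_add_finrank_dualAnnihilator_eq (Submodule.span K (Set.range ![x₀, x₁]))
  rw [Fintype.card_fin] at e1 e2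
  omega

/-- In a pencil with an invertible member `Y`, the matrix `X - μ Y` is singular when `μ` is an
eigenvalue of `X Y⁻¹`; one exists because the dimension is odd. -/
theorem exists_isSingular_mem {𝕜 B C : Type*} [RCLike 𝕜] [AddCommGroup B] [Module 𝕜 B]
    [AddCommGroup C] [Module 𝕜 C] (hB : finrank 𝕜 B = 3) (hC : finrank 𝕜 C = 3)
    {W : Submodule 𝕜 (B ⊗[𝕜] C)} (hW : 2 ≤ finrank 𝕜 W) : ∃ X ∈ W, X ≠ 0 ∧ IsSingular X := by
  obtain ⟨v, hv⟩ := exists_linearIndependent_of_le_finrank hW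
  by_cases hY : IsSingular (v 0 : B ⊗[𝕜] C)
  · exact ⟨_, (v 0).2, by simpa using hv.ne_zero 0, hY⟩
  obtain ⟨L, hL⟩ := exists_rowHom_equiv hB hC hY
  obtain ⟨μ, c, hc, h⟩ := exists_apply_eq_smul_of_odd_finrank (hC ▸ by decide)
    ((rowHom (v 1 : B ⊗[𝕜] C)).comp L.symm.toLinearMap)
  refine ⟨v 1 - μ • v 0, sub_mem (v 1).2 (Submodule.smul_mem _ _ (v 0).2), ?_, L.symm c,
    by simpa using hc, ?_⟩
  · intro h0
    have h1 : (-μ) • v 0 + (1 : 𝕜) • v 1 = 0 := Subtype.ext (by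
      simp only [Submodule.coe_add, Submodule.coe_smul, Submodule.coe_zero]
      rw [← h0]; module)
    have hv' : LinearIndependent 𝕜 ![v 0, v 1] := by
      convert hv using 1
      ext i; fin_cases i <;> rfl
    exact one_ne_zero ((LinearIndependent.pair_iff.1 hv' _ _ h1).2)
  · rw [map_sub, map_smul, ← hL, L.apply_symm_apply, ← rowHom_apply]
    simpa [sub_eq_zero] using h

theorem exists_finrank_eq_add_one {T : Type*} [AddCommGroup T] [Module K T] {W : Submodule K T}
    [FiniteDimensional K W] {X : T} (hX : X ∈ W) (hX0 : X ≠ 0) :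
    ∃ W' ≤ W, W = Submodule.span K {X} ⊔ W' ∧ finrank K W = finrank K W' + 1 := by
  obtain ⟨W₁, hW₁⟩ := Submodule.exists_isCompl (Submodule.span K {(⟨X, hX⟩ : W)})
  refine ⟨W₁.map W.subtype, Submodule.map_subtype_le _ _, ?_, ?_⟩
  · have := congrArg (Submodule.map W.subtype) hW₁.sup_eq_top
    rw [Submodule.map_sup, Submodule.map_span, Set.image_singleton, Submodule.map_subtype_top] at this
    exact this.symm
  · have := Submodule.finrank_add_eq_of_isCompl hW₁
    rw [finrank_span_singleton (by simpa using hX0)] at this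
    rw [Submodule.finrank_map_subtype_eq]
    omega

end Singular

/-! ### Covers of arbitrary spaces of `3 × 3` matrices. -/

section ThreeByThree

variable {K : Type*} [Field K] {B C : Type*} [AddCommGroup B] [Module K B] [AddCommGroup C]
  [Module K C]

/-- Suppose every such core has dimension at least two. Two cores with the same vanishing row meet
only in single-column matrices, hence trivially, so that row vanishes on all of `W`. A second row
maps `W` to a space of dimension three, so some nonzero member of `W` has a single row and is
simple. -/
theorem exists_finrank_inf_le_one (hB : finrank K B = 3) (hC : finrank K C = 3)
    {W : Submodule K (B ⊗[K] C)} (hW : finrank K W = 4)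
    (hs : ∀ X ∈ W, X ∈ simpleTensors K B C → X = 0) :
    ∃ (φ : Dual K B) (ψ : Dual K C), φ ≠ 0 ∧ ψ ≠ 0 ∧
      finrank K (W ⊓ LinearMap.ker (rowOf φ) ⊓ LinearMap.ker (colOf ψ) :
        Submodule K (B ⊗[K] C)) ≤ 1 := by
  have : FiniteDimensional K B := FiniteDimensional.of_finrank_pos (by omega)
  have : FiniteDimensional K C := FiniteDimensional.of_finrank_pos (by omega)
  let b := finBasisOfFinrankEq K B hB
  let c := finBasisOfFinrankEq K C hC
  have hb : ∀ i, b.coord i ≠ 0 := fun i h => by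
    simpa using LinearMap.congr_fun h (b i)
  have hc : ∀ i, c.coord i ≠ 0 := fun i h => by
    simpa using LinearMap.congr_fun h (c i)
  by_contra hcon
  push Not at hcon
  have h1 := hcon (b.coord 2) (c.coord 1) (hb _) (hc _)
  have h2 := hcon (b.coord 2) (c.coord 2) (hb _) (hc _)
  set R := W ⊓ LinearMap.ker (rowOf (b.coord 2))
  have hinf : (R ⊓ LinearMap.ker (colOf (c.coord 1))) ⊓ (R ⊓ LinearMap.ker (colOf (c.coord 2))) =
      ⊥ := by
    rw [eq_bot_iff]
    rintro X ⟨⟨hXR, hX1⟩, -, hX2⟩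
    refine hs X hXR.1 ?_
    rw [SetLike.mem_coe, LinearMap.mem_ker] at hX1 hX2
    rw [eq_sum_tmul_basis c X, Fin.sum_univ_three, hX1, hX2, TensorProduct.zero_tmul,
      TensorProduct.zero_tmul, add_zero, add_zero]
    exact tmul_mem_simpleTensors _ _
  have h3 := Submodule.finrank_sup_add_finrank_inf_eq (R ⊓ LinearMap.ker (colOf (c.coord 1)))
    (R ⊓ LinearMap.ker (colOf (c.coord 2)))
  rw [hinf, finrank_bot] at h3
  have h4 : finrank K (R ⊓ LinearMap.ker (colOf (c.coord 1)) ⊔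
      R ⊓ LinearMap.ker (colOf (c.coord 2)) : Submodule K (B ⊗[K] C)) ≤ finrank K R :=
    Submodule.finrank_mono (sup_le inf_le_left inf_le_left)
  have h5 := finrank_map_add_finrank_inf_ker (rowOf (b.coord 1)) R
  have h6 : finrank K (R.map (rowOf (b.coord 1))) ≤ 3 :=
    (Submodule.finrank_le _).trans hC.le
  have h7 : R ⊓ LinearMap.ker (rowOf (b.coord 1)) ≠ ⊥ := by
    intro h
    rw [h, finrank_bot] at h5
    omega
  obtain ⟨X, ⟨⟨hXW, hX2⟩, hX1⟩, hX0⟩ := Submodule.exists_mem_ne_zero_of_ne_bot h7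
  refine hX0 (hs X hXW ?_)
  rw [SetLike.mem_coe, LinearMap.mem_ker] at hX1 hX2
  rw [eq_sum_basis_tmul b X, Fin.sum_univ_three, hX1, hX2, TensorProduct.tmul_zero,
    TensorProduct.tmul_zero, add_zero, add_zero]
  exact tmul_mem_simpleTensors _ _

theorem isCoveredBy_seven_of_finrank_eq_four [CharZero K] (hB : finrank K B = 3)
    (hC : finrank K C = 3) {W : Submodule K (B ⊗[K] C)} (hW : finrank K W = 4)
    (hs : ∀ X ∈ W, X ∈ simpleTensors K B C → X = 0) :
    IsCoveredBy (simpleTensors K B C) W 7 := by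
  have : FiniteDimensional K B := FiniteDimensional.of_finrank_pos (by omega)
  have : FiniteDimensional K C := FiniteDimensional.of_finrank_pos (by omega)
  obtain ⟨φ, ψ, hφ, hψ, h1⟩ := exists_finrank_inf_le_one hB hC hW hs
  obtain ⟨e, he⟩ := exists_apply_eq_one hφ
  obtain ⟨f, hf⟩ := exists_apply_eq_one hψ
  obtain ⟨x₀, hx₀, x₁, hx₁, hx, -⟩ :=
    exists_span_pair_general_position (finrank_ker_functional hB hφ) bot_le
  obtain ⟨y₀, hy₀, y₁, hy₁, hy, -⟩ :=
    exists_span_pair_general_position (finrank_ker_functional hC hψ) bot_le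
  set N := W ⊓ LinearMap.ker (rowOf φ) ⊓ LinearMap.ker (colOf ψ) with hN
  by_cases hbot : N = ⊥
  · refine isCoveredBy_seven he hf hx₀ hx₁ hy₀ hy₁ hx hy W fun w hw hr hc => ?_
    have : w ∈ N := ⟨⟨hw, hr⟩, hc⟩
    rw [hbot, Submodule.mem_bot] at this
    rw [this]
    exact zero_mem _
  obtain ⟨n, ⟨⟨hnW, hnr⟩, hnc⟩, hn0⟩ := Submodule.exists_mem_ne_zero_of_ne_bot hbot
  have hNn : N ≤ Submodule.span K {n} := by
    have hle : Submodule.span K {n} ≤ N := by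
      rw [Submodule.span_singleton_le_iff_mem]
      exact ⟨⟨hnW, hnr⟩, hnc⟩
    exact (Submodule.eq_of_le_of_finrank_le hle (by rwa [finrank_span_singleton hn0])).ge
  rw [SetLike.mem_coe, LinearMap.mem_ker] at hnr hnc
  obtain ⟨c₀, c₁, hn⟩ := exists_eq_add_of_rowOf_eq_zero he hx hnr
  set g : C →ₗ[K] C := .id - ψ.smulRight f with hg
  have hn' : n = x₀ ⊗ₜ g c₀ + x₁ ⊗ₜ g c₁ := by
    have e1 : TensorProduct.map .id g = (LinearMap.id : B ⊗[K] C →ₗ[K] B ⊗[K] C) -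
        ((TensorProduct.mk K B C).flip f).comp (colOf ψ) :=
      TensorProduct.ext' fun b c => by
        simp [hg, TensorProduct.tmul_sub]
    have e2 := LinearMap.congr_fun e1 n
    rw [LinearMap.sub_apply, LinearMap.comp_apply, hnc, map_zero, sub_zero,
      LinearMap.id_apply] at e2
    rw [← e2]
    nth_rw 1 [hn]
    simp
  have hgker : ∀ c, ψ (g c) = 0 := fun c => by simp [hg, hf]
  have hli : LinearIndependent K ![g c₀, g c₁] := by
    by_contra h
    exact hn0 (hs n hnW (hn' ▸ mem_simpleTensors_of_right h))
  have hspan : LinearMap.ker ψ ≤ Submodule.span K {g c₁, g c₀} := by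
    have e1 := finrank_span_eq_card hli
    have e2 : Submodule.span K (Set.range ![g c₀, g c₁]) ≤ LinearMap.ker ψ := by
      rw [Submodule.span_le]
      rintro _ ⟨i, rfl⟩
      fin_cases i <;> simp [hgker]
    have e3 := Submodule.eq_of_le_of_finrank_le e2
      (by rw [e1, finrank_ker_functional hC hψ, Fintype.card_fin])
    rw [← e3, Matrix.range_cons, Matrix.range_cons, Matrix.range_empty, Set.union_empty,
      Set.union_comm]
    rfl
  -- The order of the basis of `ker ψ` is swapped so that the generator `n` of the core becomes
  -- off-diagonal.
  refine isCoveredBy_seven he hf hx₀ hx₁ (hgker c₁) (hgker c₀) hx hspan W fun w hw hr hc => ?_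
  obtain ⟨a, rfl⟩ := Submodule.mem_span_singleton.1 (hNn ⟨⟨hw, hr⟩, hc⟩)
  refine Submodule.smul_mem _ _ ?_
  rw [hn']
  simpa using smul_add_smul_mem_offDiagonal (K := K) (x₀ := x₀) (x₁ := x₁) (y₀ := g c₁)
    (y₁ := g c₀) 1 1

theorem isCoveredBy_top [FiniteDimensional K B] [FiniteDimensional K C] :
    IsCoveredBy (simpleTensors K B C) (⊤ : Submodule K (B ⊗[K] C))
      (finrank K B * finrank K C) := by
  rw [← finrank_tensorProduct, ← finrank_top]
  refine IsCoveredBy.of_span (simpleTensors K B C) ?_ (Set.subset_univ _) le_rfl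
  rw [← TensorProduct.span_tmul_eq_top]
  refine Submodule.span_mono ?_
  rintro _ ⟨b, c, rfl⟩
  exact tmul_mem_simpleTensors _ _

/-- The kernel of a bilinear form is spanned by simple tensors. -/
theorem ker_le_span_simpleTensors (N : Dual K (B ⊗[K] C)) :
    LinearMap.ker N ≤ Submodule.span K (simpleTensors K B C ∩ LinearMap.ker N) := by
  set S := Submodule.span K (simpleTensors K B C ∩ LinearMap.ker N) with hS
  have hmem : ∀ (b : B) (c : C), N (b ⊗ₜ c) = 0 → b ⊗ₜ c ∈ S := fun b c h =>
    Submodule.subset_span ⟨tmul_mem_simpleTensors b c, h⟩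
  by_cases h0 : ∀ (b : B) (c : C), N (b ⊗ₜ c) = 0
  · intro z _
    induction z using TensorProduct.induction_on with
    | zero => exact zero_mem _
    | add x y hx hy =>
      have hN : N = 0 := TensorProduct.ext' fun b c => by simp [h0]
      exact add_mem (hx (by simp [hN])) (hy (by simp [hN]))
    | tmul b c => exact hmem b c (h0 b c)
  push Not at h0
  obtain ⟨e, f, hef⟩ := h0
  -- Modulo `S` the tensor space is spanned by `e ⊗ f`, on which `N` does not vanish; `β` is tuned
  -- so that `N` vanishes on `(b' + e) ⊗ (c' + β • f)`.
  have key : ∀ z, ∃ a : K, z - a • e ⊗ₜ f ∈ S := by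
    intro z
    induction z using TensorProduct.induction_on with
    | zero => exact ⟨0, by simp⟩
    | add x y hx hy =>
      obtain ⟨a, ha⟩ := hx
      obtain ⟨a', ha'⟩ := hy
      refine ⟨a + a', ?_⟩
      convert add_mem ha ha' using 1
      module
    | tmul b c =>
      set s := N (b ⊗ₜ f) / N (e ⊗ₜ f) with hs
      set t := N (e ⊗ₜ c) / N (e ⊗ₜ f) with ht
      set b' := b - s • e with hb'
      set c' := c - t • f with hc'
      set β := -(N (b' ⊗ₜ c') / N (e ⊗ₜ f)) with hβ
      have hb0 : N (b' ⊗ₜ f) = 0 := by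
        rw [hb', TensorProduct.sub_tmul, map_sub, ← TensorProduct.smul_tmul', map_smul, smul_eq_mul,
          hs, div_mul_cancel₀ _ hef, sub_self]
      have hc0 : N (e ⊗ₜ c') = 0 := by
        rw [hc', TensorProduct.tmul_sub, map_sub, TensorProduct.tmul_smul, map_smul, smul_eq_mul,
          ht, div_mul_cancel₀ _ hef, sub_self]
      have m1 := hmem _ _ hb0
      have m2 := hmem _ _ hc0
      have m3 : (b' + e) ⊗ₜ[K] (c' + β • f) ∈ S := by
        refine hmem _ _ ?_
        simp only [TensorProduct.add_tmul, TensorProduct.tmul_add, TensorProduct.tmul_smul, map_add,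
          map_smul, hb0, hc0, add_zero, smul_eq_mul, hβ]
        field_simp
        ring
      refine ⟨s * t - β, ?_⟩
      convert add_mem (add_mem m3 (Submodule.smul_mem _ (t - β) m1))
        (Submodule.smul_mem _ (s - 1) m2) using 1
      have hb : b = b' + s • e := by rw [hb', sub_add_cancel]
      have hc : c = c' + t • f := by rw [hc', sub_add_cancel]
      rw [hb, hc]
      simp only [TensorProduct.add_tmul, TensorProduct.tmul_add, TensorProduct.tmul_smul,
        ← TensorProduct.smul_tmul']
      module
  intro z hz
  obtain ⟨a, ha⟩ := key z
  have hN : N (z - a • e ⊗ₜ f) = 0 := by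
    have : S ≤ LinearMap.ker N := Submodule.span_le.2 Set.inter_subset_right
    exact this ha
  rw [map_sub, LinearMap.mem_ker.1 hz, map_smul, smul_eq_mul, zero_sub, neg_eq_zero,
    mul_eq_zero, or_iff_left hef] at hN
  simpa [hN] using ha

theorem isCoveredBy_eight (hB : finrank K B = 3) (hC : finrank K C = 3)
    {W : Submodule K (B ⊗[K] C)} (hW : W ≠ ⊤) : IsCoveredBy (simpleTensors K B C) W 8 := by
  have : FiniteDimensional K B := FiniteDimensional.of_finrank_pos (by omega)
  have : FiniteDimensional K C := FiniteDimensional.of_finrank_pos (by omega)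
  obtain ⟨N, hN, hWN⟩ := W.exists_le_ker_of_lt_top hW.lt_top
  have h1 := Module.Dual.finrank_ker_add_one_of_ne_zero hN
  rw [finrank_tensorProduct, hB, hC] at h1
  exact (IsCoveredBy.of_span _ (ker_le_span_simpleTensors N) Set.inter_subset_right
    Set.inter_subset_left).mono hWN (by omega)

/-- A `k`-dimensional space of `3 × 3` matrices is covered by `k + 3` simple tensors. -/
theorem isCoveredBy_finrank_add_three {K : Type*} [RCLike K] {B C : Type*} [AddCommGroup B]
    [Module K B] [AddCommGroup C] [Module K C] (hB : finrank K B = 3) (hC : finrank K C = 3)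
    (W : Submodule K (B ⊗[K] C)) :
    IsCoveredBy (simpleTensors K B C) W (finrank K W + 3) := by
  have : FiniteDimensional K B := FiniteDimensional.of_finrank_pos (by omega)
  have : FiniteDimensional K C := FiniteDimensional.of_finrank_pos (by omega)
  have one : ∀ U : Submodule K (B ⊗[K] C), finrank K U = 1 → ∃ Y, U = Submodule.span K {Y} := by
    intro U hU
    obtain ⟨Y, -, hY⟩ := finrank_eq_one_iff'.1 hU
    refine ⟨Y, le_antisymm ?_ (by simp)⟩
    intro w hw
    obtain ⟨a, ha⟩ := hY ⟨w, hw⟩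
    exact Submodule.mem_span_singleton.2 ⟨a, congrArg Subtype.val ha⟩
  have three : ∀ U : Submodule K (B ⊗[K] C), finrank K U = 3 →
      IsCoveredBy (simpleTensors K B C) U 6 := by
    intro U hU
    obtain ⟨X, hX, hX0, hXs⟩ := exists_isSingular_mem hB hC (W := U) (by omega)
    obtain ⟨U', -, hUe, hf⟩ := exists_finrank_eq_add_one hX hX0
    obtain ⟨Z, hZ, hZ0, hZs⟩ := exists_isSingular_mem hB hC (W := U') (by omega)
    obtain ⟨U'', -, hUe', hf'⟩ := exists_finrank_eq_add_one hZ hZ0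
    obtain ⟨Y, rfl⟩ := one U'' (by omega)
    rw [hUe, hUe']
    exact isCoveredBy_six_of_isSingular hB hC hXs hZs
  -- From dimension six on, the nine simple tensors of a basis suffice.
  by_cases h6 : 6 ≤ finrank K W
  · refine isCoveredBy_top.mono le_top ?_
    rw [hB, hC]; omega
  have h : finrank K W = 0 ∨ finrank K W = 1 ∨ finrank K W = 2 ∨ finrank K W = 3 ∨
    finrank K W = 4 ∨ finrank K W = 5 := by omega
  rcases h with h | h | h | h | h | h <;> rw [h]
  · rw [Submodule.finrank_eq_zero.1 h]
    exact (IsCoveredBy.bot _).mono le_rfl (by omega)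
  · obtain ⟨Y, rfl⟩ := one W h
    exact (isCoveredBy_three hB Y).mono le_rfl (by omega)
  · obtain ⟨X, hX, hX0, hXs⟩ := exists_isSingular_mem hB hC (W := W) (by omega)
    obtain ⟨U', -, hUe, hf⟩ := exists_finrank_eq_add_one hX hX0
    obtain ⟨Y, rfl⟩ := one U' (by omega)
    rw [hUe]
    exact (hXs.isCoveredBy hB).sup (isCoveredBy_three hB Y)
  · exact three W h
  · by_cases hs : ∀ X ∈ W, X ∈ simpleTensors K B C → X = 0
    · exact isCoveredBy_seven_of_finrank_eq_four hB hC h hs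
    · push Not at hs
      obtain ⟨X, hX, hXs, hX0⟩ := hs
      obtain ⟨U', -, hUe, hf⟩ := exists_finrank_eq_add_one hX hX0
      rw [hUe]
      exact ((IsCoveredBy.singleton hXs).sup (three U' (by omega))).mono le_rfl (by omega)
  · refine isCoveredBy_eight hB hC ?_
    rintro rfl
    rw [finrank_top, finrank_tensorProduct, hB, hC] at h
    omega

end ThreeByThree

/-! ### Superadditivity of covering numbers, by the size of the leak. -/

section Additivity

variable {K : Type*} [RCLike K] {B' B'' C' C'' : Type*} [AddCommGroup B'] [Module K B']
  [AddCommGroup B''] [Module K B''] [AddCommGroup C'] [Module K C'] [AddCommGroup C'']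
  [Module K C'']

theorem exists_isCoveredBy_add_of_finrank_le {ι : Type*} [Finite ι] (hB : finrank K B'' = 3)
    (hC : finrank K C'' = 3) (b : ι → B' × B'') (c : ι → C' × C'')
    (hli : LinearIndependent K fun i => b i ⊗ₜ[K] c i)
    (W' : Submodule K (B' ⊗[K] C')) (W'' : Submodule K (B'' ⊗[K] C''))
    (hW' : W'.map (TensorProduct.map (.inl K B' B'') (.inl K C' C'')) ≤
      Submodule.span K (Set.range fun i => b i ⊗ₜ[K] c i))
    (hW'' : W''.map (TensorProduct.map (.inr K B' B'') (.inr K C' C'')) ≤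
      Submodule.span K (Set.range fun i => b i ⊗ₜ[K] c i))
    (hle : finrank K (Submodule.span K ((fun i => (c i).2) '' {i | (b i).1 ≠ 0})) ≤
      finrank K (Submodule.span K ((fun i => (b i).2) '' {i | (c i).1 ≠ 0}))) :
    ∃ r' r'', IsCoveredBy (simpleTensors K B' C') W' r' ∧
      IsCoveredBy (simpleTensors K B'' C'') W'' r'' ∧
      r' + r'' ≤ finrank K (Submodule.span K (Set.range fun i => b i ⊗ₜ[K] c i)) := by
  have : FiniteDimensional K B'' := FiniteDimensional.of_finrank_pos (by omega)
  have : FiniteDimensional K C'' := FiniteDimensional.of_finrank_pos (by omega)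
  obtain ⟨r', hr', hcount⟩ := exists_isCoveredBy_fst b c W' hW'
  set E := Submodule.span K ((fun i => (b i).2) '' {i | (c i).1 ≠ 0}) with hE
  set F := Submodule.span K ((fun i => (c i).2) '' {i | (b i).1 ≠ 0}) with hF
  have hEm : ∀ i, (c i).1 ≠ 0 → (b i).2 ∈ E := fun i hi => Submodule.subset_span ⟨i, hi, rfl⟩
  have hFm : ∀ i, (b i).1 ≠ 0 → (c i).2 ∈ F := fun i hi => Submodule.subset_span ⟨i, hi, rfl⟩
  refine ⟨r', _, hr', ?_, (add_assoc _ _ _).symm.trans_le hcount⟩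
  -- The excess `d` allowed by `exists_isCoveredBy_snd` is `dim E`, and `Φ`, `Ψ` are chosen to kill
  -- `E` and `F`: identities for `0`, quotient maps for `1`, functionals for `2`, zero maps for `3`.
  have hcases : finrank K E = 0 ∨ finrank K E = 1 ∨ finrank K E = 2 ∨ 3 ≤ finrank K E := by omega
  rcases hcases with h | h | h | h
  · rw [h] at hle ⊢
    have hE0 : E = ⊥ := Submodule.finrank_eq_zero.1 h
    have hF0 : F = ⊥ := Submodule.finrank_eq_zero.1 (by omega)
    refine exists_isCoveredBy_snd b c hli W'' hW'' .id .id (fun i hi => ?_) (fun i hi => ?_) 0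
      fun W _ hW => ?_
    · simpa [hE0] using hEm i hi
    · simpa [hF0] using hFm i hi
    · rw [TensorProduct.map_id, LinearMap.ker_id, le_bot_iff] at hW
      rw [hW]
      exact (IsCoveredBy.bot _).mono le_rfl (by omega)
  · rw [h] at hle ⊢
    obtain ⟨x, hx⟩ : ∃ x, E ≤ Submodule.span K {x} := by
      obtain ⟨x, hx⟩ := finrank_le_one_iff.1 h.le
      refine ⟨x, fun w hw => ?_⟩
      obtain ⟨a, ha⟩ := hx ⟨w, hw⟩
      exact Submodule.mem_span_singleton.2 ⟨a, congrArg Subtype.val ha⟩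
    obtain ⟨y, hy⟩ : ∃ y, F ≤ Submodule.span K {y} := by
      obtain ⟨x, hx⟩ := finrank_le_one_iff.1 hle
      refine ⟨x, fun w hw => ?_⟩
      obtain ⟨a, ha⟩ := hx ⟨w, hw⟩
      exact Submodule.mem_span_singleton.2 ⟨a, congrArg Subtype.val ha⟩
    refine exists_isCoveredBy_snd b c hli W'' hW'' E.mkQ F.mkQ (fun i hi => ?_) (fun i hi => ?_) 1
      fun W _ hW => ?_
    · simpa using hEm i hi
    · simpa using hFm i hi
    · refine (isCoveredBy_of_ker_le_span_singleton E.mkQ_surjective F.mkQ_surjective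
        (x := x) (y := y) (by simpa using hx) (by simpa using hy) W hW).mono le_rfl (by omega)
  · rw [h] at hle ⊢
    obtain ⟨φ, hφ, hEφ⟩ := E.exists_le_ker_of_lt_top (lt_top_iff_ne_top.2 fun ht => by
      rw [ht, finrank_top] at h; omega)
    obtain ⟨ψ, hψ, hFψ⟩ := F.exists_le_ker_of_lt_top (lt_top_iff_ne_top.2 fun ht => by
      rw [ht, finrank_top] at hle; omega)
    exact exists_isCoveredBy_snd b c hli W'' hW'' φ ψ (fun i hi => hEφ (hEm i hi))
      (fun i hi => hFψ (hFm i hi)) 2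
      fun W _ hW => isCoveredBy_of_le_ker_map_functional hB hC hφ hψ W hW
  · refine IsCoveredBy.mono (exists_isCoveredBy_snd b c hli W'' hW'' (0 : B'' →ₗ[K] K)
      (0 : C'' →ₗ[K] K) (fun i hi => rfl) (fun i hi => rfl) 3 fun W _ hW => ?_) le_rfl
      (Nat.add_le_add_left h _)
    refine (isCoveredBy_finrank_add_three hB hC W).mono le_rfl ?_
    have h1 : TensorProduct.map (0 : B'' →ₗ[K] K) (.id : C'' →ₗ[K] C'') = 0 :=
      TensorProduct.ext' fun x y => by simp
    have h2 : TensorProduct.map (.id : B'' →ₗ[K] B'') (0 : C'' →ₗ[K] K) = 0 :=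
      TensorProduct.ext' fun x y => by simp
    have h3 : W ⊓ LinearMap.ker (TensorProduct.map (.id : B'' →ₗ[K] B'') (0 : C'' →ₗ[K] K)) ⊓
        LinearMap.ker (TensorProduct.map (0 : B'' →ₗ[K] K) (.id : C'' →ₗ[K] C'')) = W := by
      rw [h1, h2, LinearMap.ker_zero, LinearMap.ker_zero, inf_top_eq, inf_top_eq]
    rw [h3]
    omega

theorem isCoveredBy_of_map_comm {K B C : Type*} [Field K] [AddCommGroup B] [Module K B]
    [AddCommGroup C] [Module K C] {W : Submodule K (B ⊗[K] C)} {r : ℕ}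
    (h : IsCoveredBy (simpleTensors K C B) (W.map (TensorProduct.comm K B C).toLinearMap) r) :
    IsCoveredBy (simpleTensors K B C) W r := by
  have := h.map (TensorProduct.comm K C B).toLinearMap (S' := simpleTensors K B C)
    fun x hx => comm_mem_simpleTensors hx
  refine this.mono ?_ le_rfl
  intro w hw
  exact ⟨_, ⟨w, hw, rfl⟩, by simp⟩

/-- Exchanging the two tensor factors swaps the two leaks, so the smaller may be taken on either
side. -/
theorem exists_isCoveredBy_add_of_linearIndependent {ι : Type*} [Finite ι]
    (hB : finrank K B'' = 3) (hC : finrank K C'' = 3) (b : ι → B' × B'') (c : ι → C' × C'')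
    (hli : LinearIndependent K fun i => b i ⊗ₜ[K] c i)
    (W' : Submodule K (B' ⊗[K] C')) (W'' : Submodule K (B'' ⊗[K] C''))
    (hW' : W'.map (TensorProduct.map (.inl K B' B'') (.inl K C' C'')) ≤
      Submodule.span K (Set.range fun i => b i ⊗ₜ[K] c i))
    (hW'' : W''.map (TensorProduct.map (.inr K B' B'') (.inr K C' C'')) ≤
      Submodule.span K (Set.range fun i => b i ⊗ₜ[K] c i)) :
    ∃ r' r'', IsCoveredBy (simpleTensors K B' C') W' r' ∧
      IsCoveredBy (simpleTensors K B'' C'') W'' r'' ∧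
      r' + r'' ≤ finrank K (Submodule.span K (Set.range fun i => b i ⊗ₜ[K] c i)) := by
  rcases le_total (finrank K (Submodule.span K ((fun i => (c i).2) '' {i | (b i).1 ≠ 0})))
    (finrank K (Submodule.span K ((fun i => (b i).2) '' {i | (c i).1 ≠ 0}))) with h | h
  · exact exists_isCoveredBy_add_of_finrank_le hB hC b c hli W' W'' hW' hW'' h
  set σ := TensorProduct.comm K (B' × B'') (C' × C'') with hσ
  have hspan : Submodule.span K (Set.range fun i => c i ⊗ₜ[K] b i) =
      (Submodule.span K (Set.range fun i => b i ⊗ₜ[K] c i)).map σ.toLinearMap := by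
    rw [Submodule.map_span, ← Set.range_comp]
    rfl
  have hfin : finrank K (Submodule.span K (Set.range fun i => c i ⊗ₜ[K] b i)) =
      finrank K (Submodule.span K (Set.range fun i => b i ⊗ₜ[K] c i)) := by
    rw [hspan]
    exact LinearEquiv.finrank_map_eq σ _
  obtain ⟨r', r'', h1, h2, h3⟩ := exists_isCoveredBy_add_of_finrank_le hC hB c b
    (by simpa [Function.comp_def, hσ] using hli.map' σ.toLinearMap σ.ker)
    (W'.map (TensorProduct.comm K B' C').toLinearMap)
    (W''.map (TensorProduct.comm K B'' C'').toLinearMap)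
    (by rw [hspan]
        refine le_trans (le_of_eq ?_) (Submodule.map_mono hW')
        rw [← Submodule.map_comp, ← Submodule.map_comp]
        congr 1
        exact TensorProduct.ext' fun x y => by simp [hσ])
    (by rw [hspan]
        refine le_trans (le_of_eq ?_) (Submodule.map_mono hW'')
        rw [← Submodule.map_comp, ← Submodule.map_comp]
        congr 1
        exact TensorProduct.ext' fun x y => by simp [hσ]) h
  exact ⟨r', r'', isCoveredBy_of_map_comm h1, isCoveredBy_of_map_comm h2, hfin ▸ h3⟩

theorem exists_isCoveredBy_add_of_finrank_eq (hB : finrank K B'' = 3) (hC : finrank K C'' = 3)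
    (W' : Submodule K (B' ⊗[K] C')) (W'' : Submodule K (B'' ⊗[K] C'')) {r : ℕ}
    (h : IsCoveredBy (simpleTensors K (B' × B'') (C' × C''))
      (W'.map (TensorProduct.map (.inl K B' B'') (.inl K C' C'')) ⊔
        W''.map (TensorProduct.map (.inr K B' B'') (.inr K C' C''))) r) :
    ∃ r' r'', IsCoveredBy (simpleTensors K B' C') W' r' ∧
      IsCoveredBy (simpleTensors K B'' C'') W'' r'' ∧ r' + r'' ≤ r := by
  obtain ⟨s, hs, hcard, hsp⟩ := h
  obtain ⟨κ, a, ha, hspan, hli⟩ := exists_linearIndependent' K (Subtype.val : s → _)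
  have : Finite κ := Finite.of_injective a ha
  choose b c hbc using fun k => hs (a k).2
  have hv : (Subtype.val : s → _) ∘ a = fun k => b k ⊗ₜ[K] c k := funext hbc
  rw [hv] at hspan hli
  rw [Subtype.range_coe] at hspan
  rw [← hspan] at hsp
  obtain ⟨r', r'', h1, h2, h3⟩ := exists_isCoveredBy_add_of_linearIndependent hB hC b c hli W' W''
    (le_sup_left.trans hsp) (le_sup_right.trans hsp)
  refine ⟨r', r'', h1, h2, h3.trans ?_⟩
  have := finrank_span_finset_le_card (R := K) s
  rw [hspan]
  exact this.trans hcard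

/-- Allows `B''` and `C''` to be replaced by `Fin 3 → K`: covers push forward along the embedding
and are pulled back by the retraction. -/
theorem exists_retraction_of_rank_le {B : Type*} [AddCommGroup B] [Module K B] {n : ℕ}
    (h : Module.rank K B ≤ n) :
    ∃ (j : B →ₗ[K] Fin n → K) (p : (Fin n → K) →ₗ[K] B), p.comp j = .id := by
  have : FiniteDimensional K B := by
    rw [FiniteDimensional, ← Module.rank_lt_aleph0_iff]
    exact h.trans_lt (Cardinal.natCast_lt_aleph0)
  have hn : finrank K B ≤ n := finrank_le_of_rank_le h
  let e := (finBasis K B).equivFun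
  refine ⟨(Function.ExtendByZero.linearMap K (Fin.castLE hn)).comp e.toLinearMap,
    e.symm.toLinearMap.comp (LinearMap.funLeft K K (Fin.castLE hn)), LinearMap.ext fun x => ?_⟩
  have : LinearMap.funLeft K K (Fin.castLE hn)
      (Function.ExtendByZero.linearMap K (Fin.castLE hn) (e x)) = e x := by
    ext i
    simp [LinearMap.funLeft_apply, (Fin.castLE_injective hn).extend_apply]
  simp [this]

theorem exists_isCoveredBy_add (hB : Module.rank K B'' ≤ 3) (hC : Module.rank K C'' ≤ 3)
    (W' : Submodule K (B' ⊗[K] C')) (W'' : Submodule K (B'' ⊗[K] C'')) {r : ℕ}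
    (h : IsCoveredBy (simpleTensors K (B' × B'') (C' × C''))
      (W'.map (TensorProduct.map (.inl K B' B'') (.inl K C' C'')) ⊔
        W''.map (TensorProduct.map (.inr K B' B'') (.inr K C' C''))) r) :
    ∃ r' r'', IsCoveredBy (simpleTensors K B' C') W' r' ∧
      IsCoveredBy (simpleTensors K B'' C'') W'' r'' ∧ r' + r'' ≤ r := by
  obtain ⟨j, p, hpj⟩ := exists_retraction_of_rank_le (n := 3) (by exact_mod_cast hB)
  obtain ⟨k, q, hqk⟩ := exists_retraction_of_rank_le (n := 3) (by exact_mod_cast hC)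
  have h' := h.map (TensorProduct.map (LinearMap.prodMap (.id : B' →ₗ[K] B') j)
    (LinearMap.prodMap (.id : C' →ₗ[K] C') k))
    (S' := simpleTensors K (B' × (Fin 3 → K)) (C' × (Fin 3 → K)))
    fun x hx => map_mem_simpleTensors _ _ hx
  rw [Submodule.map_sup, ← Submodule.map_comp, ← Submodule.map_comp, ← TensorProduct.map_comp,
    ← TensorProduct.map_comp] at h'
  obtain ⟨r', r'', h1, h2, h3⟩ := exists_isCoveredBy_add_of_finrank_eq (by simp) (by simp) W'
    (W''.map (TensorProduct.map j k)) (r := r) (by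
      convert h' using 2
      · congr 2
        · ext <;> simp
        · ext <;> simp
      · rw [← Submodule.map_comp, ← TensorProduct.map_comp]
        congr 2)
  refine ⟨r', r'', h1, ?_, h3⟩
  have := h2.map (TensorProduct.map p q) (S' := simpleTensors K B'' C'')
    fun x hx => map_mem_simpleTensors _ _ hx
  rwa [← Submodule.map_comp, ← TensorProduct.map_comp, hpj, hqk, TensorProduct.map_id,
    Submodule.map_id] at this

end Additivity

/-! ### Tensor rank as the covering number of the slice space. -/

section Slices

variable {K : Type*} [Field K] {A B C : Type*} [AddCommGroup A] [Module K A] [AddCommGroup B]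
  [Module K B] [AddCommGroup C] [Module K C]

theorem tensorRank_le {p : A ⊗[K] (B ⊗[K] C)} {r : ℕ} (h : HasDecomposition p r) :
    tensorRank p ≤ r := Nat.sInf_le h

theorem HasDecomposition.isCoveredBy {p : A ⊗[K] (B ⊗[K] C)} {r : ℕ} (h : HasDecomposition p r) :
    IsCoveredBy (simpleTensors K B C) (LinearMap.range (rowHom p)) r := by
  obtain ⟨s, hs, hp⟩ := h
  choose a b c hs using hs
  have h := IsCoveredBy.of_family (K := K) (S := simpleTensors K B C) (fun i => b i ⊗ₜ[K] c i)
    fun i => tmul_mem_simpleTensors _ _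
  rw [Fintype.card_fin] at h
  refine h.mono ?_ le_rfl
  rintro _ ⟨φ, rfl⟩
  rw [rowHom_apply]
  refine (Submodule.map_span_le (rowOf φ) (Set.range s) _).2 ?_ ⟨p, hp, rfl⟩
  rintro _ ⟨i, rfl⟩
  rw [hs]
  have hi := Submodule.smul_mem _ (φ (a i))
    (Submodule.subset_span (R := K) (Set.mem_range_self (f := fun i => b i ⊗ₜ[K] c i) i))
  simpa [rowOf] using hi

/-- The coefficients of the slices in the covering tensors are collected into the `A`-factors, one
for each covering tensor. -/
theorem hasDecomposition_of_isCoveredBy {p : A ⊗[K] (B ⊗[K] C)} {r : ℕ}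
    (h : IsCoveredBy (simpleTensors K B C) (LinearMap.range (rowHom p)) r) :
    HasDecomposition p r := by
  classical
  obtain ⟨s, hs, hcard, hsp⟩ := h
  let β := Basis.ofVectorSpace K A
  obtain ⟨c, rfl⟩ := TensorProduct.eq_repr_basis_left β p
  have hc : ∀ i, c i ∈ Submodule.span K (s : Set (B ⊗[K] C)) := fun i => by
    refine hsp ⟨β.coord i, ?_⟩
    rw [rowHom_apply, Finsupp.sum, map_sum]
    simpa [rowOf, Finsupp.single_apply] using Eq.symm
  choose g hg using fun i => Submodule.mem_span_finset.1 (hc i)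
  let a : B ⊗[K] C → A := fun t => ∑ i ∈ c.support, g i t • β i
  have hp : (c.sum fun i n => β i ⊗ₜ[K] n) = ∑ t ∈ s, a t ⊗ₜ[K] t := by
    simp only [Finsupp.sum, a, TensorProduct.sum_tmul, TensorProduct.smul_tmul]
    rw [Finset.sum_comm]
    refine Finset.sum_congr rfl fun i _ => ?_
    rw [← TensorProduct.tmul_sum, (hg i).2]
  rw [hp]
  let e : s ↪ Fin r := s.equivFin.toEmbedding.trans (Fin.castLEEmb hcard)
  -- A cover may have fewer than `r` elements; the remaining indices carry the zero tensor, which is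
  -- simple.
  refine ⟨Function.extend e (fun t => a t ⊗ₜ[K] (t : B ⊗[K] C)) 0, fun i => ?_,
    sum_mem fun t ht => Submodule.subset_span ⟨e ⟨t, ht⟩, by rw [e.injective.extend_apply]⟩⟩
  by_cases hi : ∃ t, e t = i
  · obtain ⟨t, rfl⟩ := hi
    obtain ⟨x, y, hxy⟩ := hs t.2
    exact ⟨a t, x, y, by rw [e.injective.extend_apply, ← hxy]⟩
  · exact ⟨0, 0, 0, by rw [Function.extend_apply' _ _ _ hi]; simp⟩

theorem HasDecomposition.map {A₁ B₁ C₁ : Type*} [AddCommGroup A₁] [Module K A₁] [AddCommGroup B₁]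
    [Module K B₁] [AddCommGroup C₁] [Module K C₁] {p : A ⊗[K] (B ⊗[K] C)} {r : ℕ}
    (h : HasDecomposition p r) (f : A ⊗[K] (B ⊗[K] C) →ₗ[K] A₁ ⊗[K] (B₁ ⊗[K] C₁))
    (hf : ∀ a b c, IsSimpleTensor (f (a ⊗ₜ (b ⊗ₜ c)))) : HasDecomposition (f p) r := by
  obtain ⟨s, hs, hp⟩ := h
  refine ⟨f ∘ s, fun i => ?_, ?_⟩
  · obtain ⟨a, b, c, h⟩ := hs i
    rw [Function.comp_apply, h]
    exact hf a b c
  · rw [Set.range_comp, ← Submodule.map_span]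
    exact ⟨p, hp, rfl⟩

theorem tensorRank_map_le {A₁ B₁ C₁ : Type*} [AddCommGroup A₁] [Module K A₁] [AddCommGroup B₁]
    [Module K B₁] [AddCommGroup C₁] [Module K C₁]
    (f : A ⊗[K] (B ⊗[K] C) →ₗ[K] A₁ ⊗[K] (B₁ ⊗[K] C₁))
    (hf : ∀ a b c, IsSimpleTensor (f (a ⊗ₜ (b ⊗ₜ c)))) (p : A ⊗[K] (B ⊗[K] C)) :
    tensorRank (f p) ≤ tensorRank p :=
  tensorRank_le ((hasDecomposition_tensorRank p).map f hf)

theorem tensorRank_equiv {A₁ B₁ C₁ : Type*} [AddCommGroup A₁] [Module K A₁] [AddCommGroup B₁]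
    [Module K B₁] [AddCommGroup C₁] [Module K C₁]
    (f : A ⊗[K] (B ⊗[K] C) ≃ₗ[K] A₁ ⊗[K] (B₁ ⊗[K] C₁))
    (hf : ∀ a b c, IsSimpleTensor (f (a ⊗ₜ (b ⊗ₜ c))))
    (hf' : ∀ a b c, IsSimpleTensor (f.symm (a ⊗ₜ (b ⊗ₜ c)))) (p : A ⊗[K] (B ⊗[K] C)) :
    tensorRank (f p) = tensorRank p := by
  refine le_antisymm (tensorRank_map_le f.toLinearMap hf p) ?_
  simpa using tensorRank_map_le f.symm.toLinearMap hf' (f p)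

theorem tensorRank_leftComm (p : A ⊗[K] (B ⊗[K] C)) :
    tensorRank (TensorProduct.leftComm K A B C p) = tensorRank p :=
  tensorRank_equiv _ (fun a b c => ⟨b, a, c, by simp⟩) (fun a b c => ⟨b, a, c, by simp⟩) p

theorem tensorRank_lTensor_comm (p : A ⊗[K] (B ⊗[K] C)) :
    tensorRank ((TensorProduct.comm K B C).lTensor A p) = tensorRank p :=
  tensorRank_equiv _ (fun a b c => ⟨a, c, b, by simp⟩) (fun a b c => ⟨a, c, b, by simp⟩) p

end Slices

/-! ### Symmetries, slices and subadditivity of the direct sum. -/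

section DirectSum

variable {K : Type*} [Field K] {A' A'' B' B'' C' C'' : Type*}
  [AddCommGroup A'] [Module K A'] [AddCommGroup A''] [Module K A'']
  [AddCommGroup B'] [Module K B'] [AddCommGroup B''] [Module K B'']
  [AddCommGroup C'] [Module K C'] [AddCommGroup C''] [Module K C'']

theorem leftComm_tensorDirectSum (p' : A' ⊗[K] (B' ⊗[K] C')) (p'' : A'' ⊗[K] (B'' ⊗[K] C'')) :
    TensorProduct.leftComm K _ _ _ (tensorDirectSum p' p'') =
      tensorDirectSum (TensorProduct.leftComm K _ _ _ p') (TensorProduct.leftComm K _ _ _ p'') := by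
  rw [tensorDirectSum, tensorDirectSum, map_add]
  congr 1
  · simp only [← LinearEquiv.coe_coe, ← LinearMap.comp_apply]
    congr 1
    (ext; simp)
  · simp only [← LinearEquiv.coe_coe, ← LinearMap.comp_apply]
    congr 1
    (ext; simp)

theorem lTensor_comm_tensorDirectSum (p' : A' ⊗[K] (B' ⊗[K] C'))
    (p'' : A'' ⊗[K] (B'' ⊗[K] C'')) :
    (TensorProduct.comm K _ _).lTensor _ (tensorDirectSum p' p'') =
      tensorDirectSum ((TensorProduct.comm K _ _).lTensor _ p')
        ((TensorProduct.comm K _ _).lTensor _ p'') := by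
  rw [tensorDirectSum, tensorDirectSum, map_add]
  congr 1
  · simp only [← LinearEquiv.coe_coe, ← LinearMap.comp_apply]
    congr 1
    (ext; simp)
  · simp only [← LinearEquiv.coe_coe, ← LinearMap.comp_apply]
    congr 1
    (ext; simp)

theorem map_swap_tensorDirectSum (p' : A' ⊗[K] (B' ⊗[K] C')) (p'' : A'' ⊗[K] (B'' ⊗[K] C'')) :
    TensorProduct.map (LinearEquiv.prodComm K A' A'').toLinearMap
      (TensorProduct.map (LinearEquiv.prodComm K B' B'').toLinearMap
        (LinearEquiv.prodComm K C' C'').toLinearMap) (tensorDirectSum p' p'') =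
      tensorDirectSum p'' p' := by
  rw [tensorDirectSum, tensorDirectSum, map_add, add_comm]
  simp only [← LinearMap.comp_apply, ← TensorProduct.map_comp]
  rfl

theorem tensorRank_map_map_le {A B C A₁ B₁ C₁ : Type*} [AddCommGroup A] [Module K A]
    [AddCommGroup B] [Module K B] [AddCommGroup C] [Module K C] [AddCommGroup A₁] [Module K A₁]
    [AddCommGroup B₁] [Module K B₁] [AddCommGroup C₁] [Module K C₁]
    (f : A →ₗ[K] A₁) (g : B →ₗ[K] B₁) (h : C →ₗ[K] C₁) (p : A ⊗[K] (B ⊗[K] C)) :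
    tensorRank (TensorProduct.map f (TensorProduct.map g h) p) ≤ tensorRank p :=
  tensorRank_map_le _ (fun a b c => ⟨f a, g b, h c, by simp⟩) p

theorem tensorRank_tensorDirectSum_comm (p' : A' ⊗[K] (B' ⊗[K] C'))
    (p'' : A'' ⊗[K] (B'' ⊗[K] C'')) :
    tensorRank (tensorDirectSum p' p'') = tensorRank (tensorDirectSum p'' p') := by
  refine le_antisymm ?_ ?_
  · rw [← map_swap_tensorDirectSum p'' p']
    exact tensorRank_map_map_le _ _ _ _
  · rw [← map_swap_tensorDirectSum p' p'']
    exact tensorRank_map_map_le _ _ _ _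

theorem range_rowHom_tensorDirectSum (p' : A' ⊗[K] (B' ⊗[K] C'))
    (p'' : A'' ⊗[K] (B'' ⊗[K] C'')) :
    LinearMap.range (rowHom (tensorDirectSum p' p'')) =
      (LinearMap.range (rowHom p')).map (TensorProduct.map (.inl K B' B'') (.inl K C' C'')) ⊔
      (LinearMap.range (rowHom p'')).map (TensorProduct.map (.inr K B' B'') (.inr K C' C'')) := by
  have h1 : ∀ φ, rowHom (tensorDirectSum p' p'') φ =
      TensorProduct.map (.inl K B' B'') (.inl K C' C'') (rowHom p' (φ.comp (.inl K A' A''))) +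
      TensorProduct.map (.inr K B' B'') (.inr K C' C'') (rowHom p'' (φ.comp (.inr K A' A''))) := by
    intro φ
    rw [rowHom_apply, rowHom_apply, rowHom_apply, tensorDirectSum, map_add]
    congr 1
    · simp only [← LinearMap.comp_apply]
      congr 1
      exact TensorProduct.ext' fun x y => by simp [rowOf]
    · simp only [← LinearMap.comp_apply]
      congr 1
      exact TensorProduct.ext' fun x y => by simp [rowOf]
  refine le_antisymm ?_ (sup_le ?_ ?_)
  · rintro _ ⟨φ, rfl⟩
    rw [h1]
    exact Submodule.add_mem_sup ⟨_, ⟨_, rfl⟩, rfl⟩ ⟨_, ⟨_, rfl⟩, rfl⟩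
  · rintro _ ⟨_, ⟨φ, rfl⟩, rfl⟩
    refine ⟨φ.comp (.fst K A' A''), ?_⟩
    rw [h1, LinearMap.comp_assoc, LinearMap.comp_assoc]
    simp
  · rintro _ ⟨_, ⟨φ, rfl⟩, rfl⟩
    refine ⟨φ.comp (.snd K A' A''), ?_⟩
    rw [h1, LinearMap.comp_assoc, LinearMap.comp_assoc]
    simp

theorem tensorRank_tensorDirectSum_le (p' : A' ⊗[K] (B' ⊗[K] C'))
    (p'' : A'' ⊗[K] (B'' ⊗[K] C'')) :
    tensorRank (tensorDirectSum p' p'') ≤ tensorRank p' + tensorRank p'' := by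
  refine tensorRank_le (hasDecomposition_of_isCoveredBy ?_)
  rw [range_rowHom_tensorDirectSum]
  exact ((hasDecomposition_tensorRank p').isCoveredBy.map _ fun x hx =>
    map_mem_simpleTensors _ _ hx).sup
      ((hasDecomposition_tensorRank p'').isCoveredBy.map _ fun x hx => map_mem_simpleTensors _ _ hx)

end DirectSum

/-! ### Additivity, and its reduction to one pair of factors by permutation. -/

section Main

variable {K : Type*} [RCLike K] {A' A'' B' B'' C' C'' : Type*}
  [AddCommGroup A'] [Module K A'] [AddCommGroup A''] [Module K A'']
  [AddCommGroup B'] [Module K B'] [AddCommGroup B''] [Module K B'']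
  [AddCommGroup C'] [Module K C'] [AddCommGroup C''] [Module K C'']

theorem tensorRank_tensorDirectSum_of_rank_le (hB : Module.rank K B'' ≤ 3)
    (hC : Module.rank K C'' ≤ 3) (p' : A' ⊗[K] (B' ⊗[K] C')) (p'' : A'' ⊗[K] (B'' ⊗[K] C'')) :
    tensorRank (tensorDirectSum p' p'') = tensorRank p' + tensorRank p'' := by
  refine le_antisymm (tensorRank_tensorDirectSum_le p' p'') ?_
  have h := (hasDecomposition_tensorRank (tensorDirectSum p' p'')).isCoveredBy
  rw [range_rowHom_tensorDirectSum] at h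
  obtain ⟨r', r'', h1, h2, h3⟩ := exists_isCoveredBy_add hB hC _ _ h
  exact (Nat.add_le_add (tensorRank_le (hasDecomposition_of_isCoveredBy h1))
    (tensorRank_le (hasDecomposition_of_isCoveredBy h2))).trans h3

theorem tensorRank_tensorDirectSum_of_two_rank_le
    (hdim : (Module.rank K B'' ≤ 3 ∧ Module.rank K C'' ≤ 3) ∨
      (Module.rank K A'' ≤ 3 ∧ Module.rank K C'' ≤ 3) ∨
      (Module.rank K A'' ≤ 3 ∧ Module.rank K B'' ≤ 3))
    (p' : A' ⊗[K] (B' ⊗[K] C')) (p'' : A'' ⊗[K] (B'' ⊗[K] C'')) :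
    tensorRank (tensorDirectSum p' p'') = tensorRank p' + tensorRank p'' := by
  rcases hdim with ⟨h1, h2⟩ | ⟨h1, h2⟩ | ⟨h1, h2⟩
  · exact tensorRank_tensorDirectSum_of_rank_le h1 h2 p' p''
  · rw [← tensorRank_leftComm, leftComm_tensorDirectSum,
      tensorRank_tensorDirectSum_of_rank_le h1 h2, tensorRank_leftComm, tensorRank_leftComm]
  · rw [← tensorRank_lTensor_comm, ← tensorRank_leftComm, lTensor_comm_tensorDirectSum,
      leftComm_tensorDirectSum, tensorRank_tensorDirectSum_of_rank_le h1 h2, tensorRank_leftComm,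
      tensorRank_leftComm, tensorRank_lTensor_comm, tensorRank_lTensor_comm]

end Main

end TensorAdditivity

theorem mainTheorem2 {𝕜 : Type*} [RCLike 𝕜] {A' A'' B' B'' C' C'' : Type*}
    [AddCommGroup A'] [Module 𝕜 A'] [AddCommGroup A''] [Module 𝕜 A'']
    [AddCommGroup B'] [Module 𝕜 B'] [AddCommGroup B''] [Module 𝕜 B'']
    [AddCommGroup C'] [Module 𝕜 C'] [AddCommGroup C''] [Module 𝕜 C'']
    (hdim :
      (Module.rank 𝕜 B'' ≤ 3 ∧ Module.rank 𝕜 C'' ≤ 3) ∨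
      (Module.rank 𝕜 A'' ≤ 3 ∧ Module.rank 𝕜 C'' ≤ 3) ∨
      (Module.rank 𝕜 A'' ≤ 3 ∧ Module.rank 𝕜 B'' ≤ 3) ∨
      (Module.rank 𝕜 B' ≤ 3 ∧ Module.rank 𝕜 C' ≤ 3) ∨
      (Module.rank 𝕜 A' ≤ 3 ∧ Module.rank 𝕜 C' ≤ 3) ∨
      (Module.rank 𝕜 A' ≤ 3 ∧ Module.rank 𝕜 B' ≤ 3))
    (p' : A' ⊗[𝕜] (B' ⊗[𝕜] C')) (p'' : A'' ⊗[𝕜] (B'' ⊗[𝕜] C'')) :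
    TensorAdditivity.tensorRank (TensorAdditivity.tensorDirectSum p' p'') =
      TensorAdditivity.tensorRank p' + TensorAdditivity.tensorRank p'' := by

  rcases hdim with h | h | h | h
  · exact TensorAdditivity.tensorRank_tensorDirectSum_of_two_rank_le (.inl h) p' p''
  · exact TensorAdditivity.tensorRank_tensorDirectSum_of_two_rank_le (.inr (.inl h)) p' p''
  · exact TensorAdditivity.tensorRank_tensorDirectSum_of_two_rank_le (.inr (.inr h)) p' p''
  · rw [TensorAdditivity.tensorRank_tensorDirectSum_comm, add_comm]
    exact TensorAdditivity.tensorRank_tensorDirectSum_of_two_rank_le h p'' p'
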